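/- **Setting.** Individuals are $i=1,2,\dots$; the sample of size $N$ consists of $i\in[N]=\{1,\dots,N\}$. Time is counted from the end of the pre-treatment phase: nobody is treated in periods $s\le 0$, the sample of size $N$ observes the $T_0=T_0(N)$ pre-treatment periods $s=1-T_0,\dots,0$, and $t>0$ is a fixed post-treatment period. Write $\mathcal S_t=\{s\le 0\}\cup\{t\}$. Observed are outcomes $Y_{i,s}$ and treatment indicators $w_{i,s}\in\{0,1\}$; $Y_{i,s}(0)$ is the untreated potential outcome, $\alpha_i\in\mathbb R^{d}$ and $\lambda_s\in\mathcal L$ are latent factors, and $$Y_{i,s}(0)=\mu^{(0)}_{i,s}+u_{i,s},\quad \mu^{(0)}_{i,s}=\mu^{(0)}(\alpha_i,\lambda_s),\qquad w_{i,s}=p_{i,s}+\epsilon_{i,s},\quad p_{i,s}=p_s(\alpha_i)$$ (the function $p_s$ may also depend on $\lambda_s$). $\mathbb E_t,P_t$ denote expectation and probability conditional on $\lambda_t$. The period-$t$ population is sampled at random: conditionally on $\lambda_t$, the vectors $(\alpha_i,Y_{i,t}(0),Y_{i,t},w_{i,t})$ are i.i.d. over $i$, and $\mathbb E[Y_{i,t}^2]<\infty$.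 Put $$\mathrm{ATT}_t=\mathbb E_t[Y_{i,t}-Y_{i,t}(0)\mid w_{i,t}=1],\qquad \psi_{i,t}=Y_{i,t}w_{i,t}-\frac{(1-w_{i,t})Y_{i,t}p_{i,t}+(w_{i,t}-p_{i,t})\mu^{(0)}_{i,t}}{1-p_{i,t}},\qquad V_t=\frac{\mathbb E_t[(\psi_{i,t}-w_{i,t}\mathrm{ATT}_t)^2]}{P_t(w_{i,t}=1)^2}.$$ **Assumptions** (for all $i\ne j$ and $s\in\mathcal S_t$). 1. If $w_{i,s}=0$ then $Y_{i,s}=Y_{i,s}(0)$. 2. $Y_{i,s}(0)\perp w_{i,s}\mid \alpha_i,\lambda_s$. 3. $Y_{i,s}(0)\perp Y_{j,s}(0)\mid\{\alpha_k\}_{k\le N},\lambda_s$ for all $N\ge i,j$. 4. (i) For some $c>0$, $c\le p_{i,t}\le 1-c$ a.s. (ii) Conditionally on all latent factors $(\alpha,\lambda)$ the errors $u_{i,s},\epsilon_{i,s}$ have mean zero, are sub-Gaussian ($\mathbb E[e^{\eta u_{i,s}}\mid\alpha,\lambda]\le e^{\delta\eta^2}$ for all $\eta$, a.s., with one constant $\delta$,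 and likewise for $\epsilon_{i,s}$), and are jointly independent. (iii) The $\alpha_i$ are i.i.d., the $\lambda_s$ are i.i.d. with law $\pi$, and the two families are independent; $\operatorname{supp}(\alpha)\subseteq\mathcal A$ with $\mathcal A$ compact, and for some $0<\underline c<\bar c$, $\underline c\,\eta^{d}\le P(\|a-\alpha_i\|\le\eta)\le\bar c\,\eta^{d}$ for all $a\in\operatorname{supp}(\alpha)$, $0<\eta\le1$. (iv) $\mu^{(0)}$ and $p_s$ are uniformly bounded on $\mathcal A\times\mathcal L$ and Lipschitz in $\alpha\in\mathcal A$, uniformly in $\lambda$ and $s$. (v) The kernel $K:\mathbb R_+\to\mathbb R$ is nonnegative, $K(0)>0$, compactly supported, bounded and Lipschitz. (vi) For some $c_1,c_2>0$ and all $\alpha_1,\alpha_2\in\mathcal A$, with $\Delta(\lambda)=\mu^{(0)}(\alpha_1,\lambda)-\mu^{(0)}(\alpha_2,\lambda)$: $\int\Delta^2d\pi\ge c_1\|\alpha_1-\alpha_2\|^2$ and $\sup_{\alpha\in\operatorname{supp}(\alpha)}\int\mu^{(0)}(\alpha,\lambda)\Delta(\lambda)\,d\pi(\lambda)\ge c_2\big(\int\Delta^2d\pi\big)^{1/2}$.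 **Estimator.** $[N]$ is partitioned, deterministically or at random but independently of the panel, into a fixed number of folds $\mathcal I_k$; $\mathcal I_{-k}=[N]\setminus\mathcal I_k$. For $i\in\mathcal I_k$, $j\in\mathcal I_{-k}$ let $\hat d_{i,j}=\frac1{T_0}\max_{\ell\in\mathcal I_{-k},\,\ell\ne i,j}\big|\sum_{s=1-T_0}^{0}Y_{\ell,s}(Y_{i,s}-Y_{j,s})\big|$, and for $i\in\mathcal I_k$ $$\hat\mu^{(0)}_{i,t}=\frac{\sum_{j\in\mathcal I_{-k},w_{j,t}=0}K(\hat d_{i,j}/h)Y_{j,t}}{\sum_{j\in\mathcal I_{-k},w_{j,t}=0}K(\hat d_{i,j}/h)},\qquad \hat p_{i,t}=\frac{\sum_{j\in\mathcal I_{-k}}K(\hat d_{i,j}/h)w_{j,t}}{\sum_{j\in\mathcal I_{-k}}K(\hat d_{i,j}/h)},$$ where $h>0$ is selected by any (possibly data-dependent) rule, such as cross-validation, from a list of $b$ candidate bandwidths that may depend on $N$, with $b$ fixed. With $N_{1,t}=\sum_{i\le N}w_{i,t}$, $$\widehat{\mathrm{ATT}}_t=\frac1{N_{1,t}}\sum_{i=1}^N\Big(Y_{i,t}w_{i,t}-\frac{(1-w_{i,t})Y_{i,t}\hat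 p_{i,t}+(w_{i,t}-\hat p_{i,t})\hat\mu^{(0)}_{i,t}}{1-\hat p_{i,t}}\Big).$$ **Theorem.** Suppose Assumptions 1–4 hold, $\max_{i\in[N]}|\hat p_{i,t}-p_{i,t}|=o_p(1)$, $\max_{i\in[N]}|\hat\mu^{(0)}_{i,t}-\mu^{(0)}_{i,t}|=o_p(1)$, $\max_{i\in[N]}|(p_{i,t}-\hat p_{i,t})(\mu^{(0)}_{i,t}-\hat\mu^{(0)}_{i,t})|=o_p(N^{-1/2})$, and for each $k$, $|\mathcal I_k|/N\to c_k$ (in probability) for some finite $c_k>0$. Then $$\sqrt N\,\widehat{\mathrm{ATT}}_t=\frac{\sqrt N}{N_{1,t}}\sum_{i=1}^N\psi_{i,t}+o_p(1),$$ and $\sqrt N(\widehat{\mathrm{ATT}}_t-\mathrm{ATT}_t)$ is asymptotically $N(0,V_t)$ conditionally on $\lambda_t$: for every bounded continuous $f:\mathbb R\to\mathbb R$, $\mathbb E_t\big[f\big(\sqrt N(\widehat{\mathrm{ATT}}_t-\mathrm{ATT}_t)\big)\big]\to\int f\,dN(0,V_t)$ in probability. -/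

import Mathlib

open MeasureTheory ProbabilityTheory Filter Topology
open scoped NNReal ENNReal BoundedContinuousFunction

noncomputable section

/-- A panel with latent individual factors `α i` in `ℝ^d` and latent period factors `lam s`.
Individuals are indexed by `ℕ` (a sample of size `N` consists of `i < N`). Time is measured
relative to the end of the pre-treatment phase: nobody is treated in a period `s ≤ 0`, and the
post-treatment periods are `s = 1, 2, …`; a sample whose pre-treatment phase consists of `T₀`
periods observes the pre-treatment periods `s = 1 - T₀, …, 0`.
`Y0` is the untreated potential outcome, `Y` the observed outcome, `w` the treatment indicator,
`μ0` the regression function of the untreated outcome, `p s` the propensity function of period `s`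
(which is allowed to depend on the period factor as well). -/
structure LatentPanel (Ω : Type*) [MeasurableSpace Ω] (L : Type*) [MeasurableSpace L]
    (d : ℕ) where
  α : ℕ → Ω → EuclideanSpace ℝ (Fin d)
  lam : ℤ → Ω → L
  Y0 : ℕ → ℤ → Ω → ℝ
  Y : ℕ → ℤ → Ω → ℝ
  w : ℕ → ℤ → Ω → ℝ
  μ0 : EuclideanSpace ℝ (Fin d) → L → ℝ
  p : ℤ → EuclideanSpace ℝ (Fin d) → L → ℝ
  measurable_α : ∀ i, Measurable (α i)
  measurable_lam : ∀ s, Measurable (lam s)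
  measurable_Y0 : ∀ i s, Measurable (Y0 i s)
  measurable_Y : ∀ i s, Measurable (Y i s)
  measurable_w : ∀ i s, Measurable (w i s)
  measurable_μ0 : Measurable (Function.uncurry μ0)
  measurable_p : ∀ s, Measurable (Function.uncurry (p s))
  w_binary : ∀ i s ω, w i s ω = 0 ∨ w i s ω = 1
  w_pre : ∀ i s ω, s ≤ 0 → w i s ω = 0

/-- The periods that enter the analysis of period `t`: the pre-treatment periods and `t`. -/
def obsPeriods (t : ℤ) : Set ℤ := {s | s ≤ 0 ∨ s = t}

/-- Doubly robust score of the ATT at outcome `y`, treatment `w`, propensity `p`, untreated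
mean `m`. -/
def drScore (y w p m : ℝ) : ℝ := y * w - ((1 - w) * y * p + (w - p) * m) / (1 - p)

namespace LatentPanel

variable {Ω : Type*} [mΩ : MeasurableSpace Ω] {L : Type*} [MeasurableSpace L] {d : ℕ}

/-- `μ⁽⁰⁾_{i,s} = μ⁽⁰⁾(α_i, λ_s)`. -/
def μ0At (M : LatentPanel Ω L d) (i : ℕ) (s : ℤ) (ω : Ω) : ℝ := M.μ0 (M.α i ω) (M.lam s ω)

/-- `p_{i,s}`, the value of the propensity function of period `s` at individual `i`. -/
def pAt (M : LatentPanel Ω L d) (i : ℕ) (s : ℤ) (ω : Ω) : ℝ := M.p s (M.α i ω) (M.lam s ω)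

/-- Outcome residual `u_{i,s}`. -/
def u (M : LatentPanel Ω L d) (i : ℕ) (s : ℤ) (ω : Ω) : ℝ := M.Y0 i s ω - M.μ0At i s ω

/-- Treatment residual `ε_{i,s}`. -/
def eps (M : LatentPanel Ω L d) (i : ℕ) (s : ℤ) (ω : Ω) : ℝ := M.w i s ω - M.pAt i s ω

/-- The family of all error terms of the periods that matter for period `t`. -/
def err (M : LatentPanel Ω L d) (t : ℤ) (x : ℕ × obsPeriods t × Bool) : Ω → ℝ :=
  if x.2.2 then M.u x.1 x.2.1 else M.eps x.1 x.2.1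

/-- The σ-algebra of the period factor `λ_s`. -/
abbrev sigmaPeriod (M : LatentPanel Ω L d) (s : ℤ) : MeasurableSpace Ω :=
  MeasurableSpace.comap (M.lam s) inferInstance

/-- The σ-algebra of `(α_i, λ_s)`. -/
abbrev sigmaOwn (M : LatentPanel Ω L d) (i : ℕ) (s : ℤ) : MeasurableSpace Ω :=
  MeasurableSpace.comap (fun ω => (M.α i ω, M.lam s ω)) inferInstance

/-- The σ-algebra of `({α_k}_{k < N}, λ_s)`. -/
abbrev sigmaSample (M : LatentPanel Ω L d) (N : ℕ) (s : ℤ) : MeasurableSpace Ω :=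
  MeasurableSpace.comap (fun ω => (fun k : Fin N => M.α k ω, M.lam s ω)) inferInstance

/-- The σ-algebra of all latent factors `({α_k}_k, {λ_s}_s)`. -/
abbrev sigmaAll (M : LatentPanel Ω L d) : MeasurableSpace Ω :=
  MeasurableSpace.comap (fun ω => (fun k => M.α k ω, fun s => M.lam s ω)) inferInstance

theorem sigmaPeriod_le (M : LatentPanel Ω L d) (s : ℤ) : M.sigmaPeriod s ≤ mΩ :=
  (M.measurable_lam s).comap_le

theorem sigmaOwn_le (M : LatentPanel Ω L d) (i : ℕ) (s : ℤ) : M.sigmaOwn i s ≤ mΩ :=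
  ((M.measurable_α i).prodMk (M.measurable_lam s)).comap_le

theorem sigmaSample_le (M : LatentPanel Ω L d) (N : ℕ) (s : ℤ) : M.sigmaSample N s ≤ mΩ :=
  ((measurable_pi_lambda _ fun k : Fin N => M.measurable_α k).prodMk
    (M.measurable_lam s)).comap_le

theorem sigmaAll_le (M : LatentPanel Ω L d) : M.sigmaAll ≤ mΩ :=
  ((measurable_pi_lambda _ fun k => M.measurable_α k).prodMk
    (measurable_pi_lambda _ fun s => M.measurable_lam s)).comap_le

/-- No anticipation. -/
def NoAnticipation (M : LatentPanel Ω L d) (P : Measure Ω) (t : ℤ) : Prop :=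
  ∀ i, ∀ s ∈ obsPeriods t, ∀ᵐ ω ∂P, M.w i s ω = 0 → M.Y i s ω = M.Y0 i s ω

/-- Latent unconfoundedness. -/
def LatentUnconfoundedness [StandardBorelSpace Ω] (M : LatentPanel Ω L d) (P : Measure Ω)
    [IsFiniteMeasure P] (t : ℤ) : Prop :=
  ∀ i, ∀ s ∈ obsPeriods t,
    CondIndepFun (M.sigmaOwn i s) (M.sigmaOwn_le i s) (M.Y0 i s) (M.w i s) P

/-- Latent independence. -/
def LatentIndependence [StandardBorelSpace Ω] (M : LatentPanel Ω L d) (P : Measure Ω)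
    [IsFiniteMeasure P] (t : ℤ) : Prop :=
  ∀ (N i j : ℕ), i < N → j < N → i ≠ j → ∀ s ∈ obsPeriods t,
    CondIndepFun (M.sigmaSample N s) (M.sigmaSample_le N s) (M.Y0 i s) (M.Y0 j s) P

/-- Model and latent factors: overlap, errors, latent factors, regression functions, kernel and
separation. `𝒜` is the compact set of individual factors and `K` the kernel. -/
structure ModelAssumption [StandardBorelSpace Ω] (M : LatentPanel Ω L d) (P : Measure Ω)
    [IsFiniteMeasure P] (t : ℤ) (𝒜 : Set (EuclideanSpace ℝ (Fin d))) (K : ℝ≥0 → ℝ) : Prop where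
  /-- overlap -/
  overlap : ∃ c : ℝ, 0 < c ∧ ∀ i, ∀ᵐ ω ∂P, c ≤ M.pAt i t ω ∧ M.pAt i t ω ≤ 1 - c
  /-- the errors are centred, uniformly sub-Gaussian and jointly independent, conditionally on
  the latent factors -/
  err_mean : ∀ x, P[M.err t x | M.sigmaAll] =ᵐ[P] 0
  err_subgaussian : ∃ δ : ℝ≥0, ∀ x,
    HasCondSubgaussianMGF M.sigmaAll M.sigmaAll_le (M.err t x) δ P
  err_indep : iCondIndepFun M.sigmaAll M.sigmaAll_le (M.err t) P
  /-- the latent factors -/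
  compact : IsCompact 𝒜
  support_subset : (P.map (M.α 0)).support ⊆ 𝒜
  α_indep : iIndepFun M.α P
  α_ident : ∀ i, IdentDistrib (M.α i) (M.α 0) P P
  lam_indep : iIndepFun M.lam P
  lam_ident : ∀ s, IdentDistrib (M.lam s) (M.lam t) P P
  α_lam_indep : IndepFun (fun ω i => M.α i ω) (fun ω s => M.lam s ω) P
  ball_prob : ∃ c c' : ℝ, 0 < c ∧ c < c' ∧ ∀ a ∈ (P.map (M.α 0)).support, ∀ η : ℝ,
    0 < η → η ≤ 1 → ∀ i, c * η ^ d ≤ P.real {ω | ‖a - M.α i ω‖ ≤ η} ∧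
      P.real {ω | ‖a - M.α i ω‖ ≤ η} ≤ c' * η ^ d
  /-- the regression functions -/
  μ0_bdd : ∃ B : ℝ, ∀ a ∈ 𝒜, ∀ l, |M.μ0 a l| ≤ B
  p_bdd : ∃ B : ℝ, ∀ s ∈ obsPeriods t, ∀ a ∈ 𝒜, ∀ l, |M.p s a l| ≤ B
  μ0_lipschitz : ∃ L₀ : ℝ, ∀ a ∈ 𝒜, ∀ a' ∈ 𝒜, ∀ l, |M.μ0 a l - M.μ0 a' l| ≤ L₀ * ‖a - a'‖
  p_lipschitz : ∃ Lp : ℝ, ∀ s ∈ obsPeriods t, ∀ a ∈ 𝒜, ∀ a' ∈ 𝒜, ∀ l,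
    |M.p s a l - M.p s a' l| ≤ Lp * ‖a - a'‖
  /-- the kernel -/
  K_nonneg : ∀ z, 0 ≤ K z
  K_zero : 0 < K 0
  K_compact : HasCompactSupport K
  K_bdd : ∃ B : ℝ, ∀ z, K z ≤ B
  K_lipschitz : ∃ C : ℝ≥0, LipschitzWith C K
  /-- separation; the period factors have law `P.map (M.lam t)` -/
  separation : ∃ c₁ : ℝ, 0 < c₁ ∧ ∀ a₁ ∈ 𝒜, ∀ a₂ ∈ 𝒜,
    c₁ * ‖a₁ - a₂‖ ^ 2 ≤ ∫ l, (M.μ0 a₁ l - M.μ0 a₂ l) ^ 2 ∂(P.map (M.lam t))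
  closeness : ∃ c₂ : ℝ, 0 < c₂ ∧ ∀ a₁ ∈ 𝒜, ∀ a₂ ∈ 𝒜,
    c₂ * √(∫ l, (M.μ0 a₁ l - M.μ0 a₂ l) ^ 2 ∂(P.map (M.lam t))) ≤
      ⨆ a : (P.map (M.α 0)).support,
        ∫ l, M.μ0 a l * (M.μ0 a₁ l - M.μ0 a₂ l) ∂(P.map (M.lam t))

/-- The period-`t` variables `(α_i, Y_{i,t}(0), Y_{i,t}, w_{i,t})` of individual `i`. -/
def unitData (M : LatentPanel Ω L d) (t : ℤ) (i : ℕ) (ω : Ω) :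
    EuclideanSpace ℝ (Fin d) × ℝ × ℝ × ℝ :=
  (M.α i ω, M.Y0 i t ω, M.Y i t ω, M.w i t ω)

/-- Random sampling from the period-`t` population: conditionally on `λ_t` the individuals are
i.i.d., with square-integrable observed outcomes. -/
structure RandomSampling [StandardBorelSpace Ω] (M : LatentPanel Ω L d) (P : Measure Ω)
    [IsFiniteMeasure P] (t : ℤ) : Prop where
  indep : iCondIndepFun (M.sigmaPeriod t) (M.sigmaPeriod_le t) (M.unitData t) P
  ident : ∀ i, IdentDistrib (fun ω => (M.lam t ω, M.unitData t i ω))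
    (fun ω => (M.lam t ω, M.unitData t 0 ω)) P P
  sq_integrable : ∀ i, MemLp (M.Y i t) 2 P

/-- `P_t(w_{i,t} = 1)`, the treatment probability given `λ_t`. -/
def treatProb (M : LatentPanel Ω L d) (P : Measure Ω) (t : ℤ) : Ω → ℝ :=
  P[M.w 0 t | M.sigmaPeriod t]

/-- `ATT_t = E_t[Y_{i,t} - Y_{i,t}(0) | w_{i,t} = 1]`, where `E_t` is expectation given `λ_t`.
As individuals are identically distributed, individual `0` stands for a generic one. -/
def ATT (M : LatentPanel Ω L d) (P : Measure Ω) (t : ℤ) (ω : Ω) : ℝ :=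
  (P[fun ω => M.w 0 t ω * (M.Y 0 t ω - M.Y0 0 t ω) | M.sigmaPeriod t]) ω / M.treatProb P t ω

/-- The oracle score, at the true propensity and the true untreated mean. -/
def oracleScore (M : LatentPanel Ω L d) (t : ℤ) (i : ℕ) (ω : Ω) : ℝ :=
  drScore (M.Y i t ω) (M.w i t ω) (M.pAt i t ω) (M.μ0At i t ω)

/-- The asymptotic variance
`V_t = E_t[(ψ_{i,t} - w_{i,t} ATT_t)²] / P_t(w_{i,t} = 1)²`, with `ψ` the oracle score. -/
def asympVar (M : LatentPanel Ω L d) (P : Measure Ω) (t : ℤ) (ω : Ω) : ℝ :=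
  (P[fun ω => (M.oracleScore t 0 ω - M.w 0 t ω * M.ATT P t ω) ^ 2 | M.sigmaPeriod t]) ω /
    M.treatProb P t ω ^ 2

/-- Number of treated individuals in period `t` in the sample of size `N`. -/
def numTreated (M : LatentPanel Ω L d) (t : ℤ) (N : ℕ) (ω : Ω) : ℝ :=
  ∑ i ∈ Finset.range N, M.w i t ω

/-- The infeasible estimate of the ATT at the true nuisance parameters. -/
def oracleATT (M : LatentPanel Ω L d) (t : ℤ) (N : ℕ) (ω : Ω) : ℝ :=
  (∑ i ∈ Finset.range N, M.oracleScore t i ω) / M.numTreated t N ω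

end LatentPanel

/-- The tuning of the cross-fitted estimator with `J` folds and `b` candidate bandwidths. For
sample size `N`: the number `T0 N` of pre-treatment periods, the candidate bandwidths `h N`, the
(possibly random) fold `fold N ω i` of each individual `i < N`, and the index `sel N ω` of the
selected bandwidth, which may depend on all the data in an arbitrary measurable way (so minimizers
of the cross-validation error are included). -/
structure CrossFitting (Ω : Type*) [MeasurableSpace Ω] (J b : ℕ) where
  T0 : ℕ → ℕ
  h : ℕ → Fin b → ℝ≥0
  fold : ℕ → Ω → ℕ → Fin J
  sel : ℕ → Ω → Fin b
  h_pos : ∀ N m, 0 < h N m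
  measurable_fold : ∀ N, Measurable (fold N)
  measurable_sel : ∀ N, Measurable (sel N)

namespace CrossFitting

variable {Ω : Type*} [MeasurableSpace Ω] {L : Type*} [MeasurableSpace L] {d J b : ℕ}

/-- The fold `I_k` of the sample of size `N`. -/
def foldSet (C : CrossFitting Ω J b) (N : ℕ) (ω : Ω) (k : Fin J) : Finset ℕ :=
  (Finset.range N).filter fun i => C.fold N ω i = k

/-- `I_{-k}` for the fold `k` that contains `i`. -/
def otherFolds (C : CrossFitting Ω J b) (N : ℕ) (ω : Ω) (i : ℕ) : Finset ℕ :=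
  (Finset.range N).filter fun j => C.fold N ω j ≠ C.fold N ω i

/-- The partition is drawn independently of the panel. -/
def FoldsIndependent (C : CrossFitting Ω J b) (M : LatentPanel Ω L d) (P : Measure Ω) : Prop :=
  ∀ N, IndepFun (C.fold N)
    (fun ω => ((fun i => M.α i ω, fun s => M.lam s ω),
      fun (i : ℕ) (s : ℤ) => (M.Y0 i s ω, M.Y i s ω, M.w i s ω))) P

/-- The pseudo-distance
`d̂_{i,j} = T₀⁻¹ max_ℓ |⟨Y_ℓ, Y_i - Y_j⟩|` over the pre-treatment periods, with `ℓ` ranging over the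
folds that do not contain `i`, and `ℓ ≠ i, j`. -/
def pseudoDist (C : CrossFitting Ω J b) (M : LatentPanel Ω L d) (N : ℕ) (i j : ℕ) (ω : Ω) : ℝ≥0 :=
  ((C.T0 N : ℝ≥0))⁻¹ * ((C.otherFolds N ω i).filter fun l => l ≠ i ∧ l ≠ j).sup fun l =>
    ‖∑ s ∈ Finset.Ioc (-(C.T0 N : ℤ)) 0, M.Y l s ω * (M.Y i s ω - M.Y j s ω)‖₊

/-- Kernel weight `K(d̂_{i,j} / h)` for the selected bandwidth `h`. -/
def weight (C : CrossFitting Ω J b) (M : LatentPanel Ω L d) (K : ℝ≥0 → ℝ) (N : ℕ) (i j : ℕ)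
    (ω : Ω) : ℝ :=
  K (C.pseudoDist M N i j ω / C.h N (C.sel N ω))

/-- Cross-fitted estimate of `μ⁽⁰⁾_{i,t}`, from the untreated individuals of the other folds. -/
def muHat (C : CrossFitting Ω J b) (M : LatentPanel Ω L d) (K : ℝ≥0 → ℝ) (t : ℤ) (N : ℕ) (i : ℕ)
    (ω : Ω) : ℝ :=
  (∑ j ∈ (C.otherFolds N ω i).filter (fun j => M.w j t ω = 0),
      C.weight M K N i j ω * M.Y j t ω) /
    ∑ j ∈ (C.otherFolds N ω i).filter (fun j => M.w j t ω = 0), C.weight M K N i j ω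

/-- Cross-fitted estimate of `p_{i,t}`. -/
def pHat (C : CrossFitting Ω J b) (M : LatentPanel Ω L d) (K : ℝ≥0 → ℝ) (t : ℤ) (N : ℕ) (i : ℕ)
    (ω : Ω) : ℝ :=
  (∑ j ∈ C.otherFolds N ω i, C.weight M K N i j ω * M.w j t ω) /
    ∑ j ∈ C.otherFolds N ω i, C.weight M K N i j ω

/-- The cross-fitted doubly robust estimate of `ATT_t`. -/
def attHat (C : CrossFitting Ω J b) (M : LatentPanel Ω L d) (K : ℝ≥0 → ℝ) (t : ℤ) (N : ℕ)
    (ω : Ω) : ℝ :=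
  (∑ i ∈ Finset.range N,
    drScore (M.Y i t ω) (M.w i t ω) (C.pHat M K t N i ω) (C.muHat M K t N i ω)) /
    M.numTreated t N ω

end CrossFitting

/-- `X N = o_p(1)`. -/
def IsLittleOpOne {Ω : Type*} [MeasurableSpace Ω] (P : Measure Ω) (X : ℕ → Ω → ℝ) : Prop :=
  TendstoInMeasure P X atTop fun _ => 0

/-- `X N` is asymptotically `N(0, V)` conditionally on the σ-algebra `m`: for every bounded
continuous `f`, `E[f(X N) | m] → ∫ f dN(0, V)` in probability. -/
def CondAsympNormal {Ω : Type*} [MeasurableSpace Ω] (P : Measure Ω) (m : MeasurableSpace Ω)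
    (X : ℕ → Ω → ℝ) (V : Ω → ℝ) : Prop :=
  ∀ f : ℝ →ᵇ ℝ, TendstoInMeasure P (fun N => P[fun ω => f (X N ω) | m]) atTop
    fun ω => ∫ x, f x ∂(gaussianReal 0 (V ω).toNNReal)

end

/-!
The doubly robust score is affine in each of the untreated mean and the odds `p / (1 - p)` of the
propensity, so its estimation error is exactly
`-(Δμ / (1 - p)) ε - Δodds (1 - w) (Y - μ) + (1 - w) Δμ Δodds` (`drScore_sub_drScore`), where `Δμ` and
`Δodds` are the errors of the nuisance estimates, and `(1 - w) (Y - μ) = (1 - w) u`. The product term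
is `o_p(N^{-1/2})` uniformly over individuals by hypothesis. What has to be shown is that the two
linear terms, summed over the sample, are `o_p(√N)`, although the nuisance errors are only `o_p(1)`.

This is what cross-fitting achieves. Fix a partition and a bandwidth. The nuisance estimates of an
individual are then functions of pre-treatment outcomes and of period-`t` data of other folds, and
nobody is treated in pre-treatment periods, so the outcomes are untreated ones. Given the latent factors,
all errors are independent and centred. Hence within a fold the summands `Z_i e_i` are orthogonal:
neither coefficient `Z_i`, `Z_j` involves the error `e_j`. Truncating the nuisance errors at `η`,
which changes nothing with probability tending to one, bounds the second moment of the sum by a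
constant times `η² N` (`CrossFitting.exists_lintegral_sq_linearTerm_le`). The random partition is
independent of the panel and can be conditioned on. The bandwidth may depend on the data in any way,
but it has `b` values, so summing over them costs a factor `b`
(`CrossFitting.exists_lintegral_sq_linearPart_le`). Markov's inequality and `η → 0` conclude
(`CrossFitting.tendstoInMeasure_scoreError`).

For the limit law, the oracle score minus `w_i ATT` equals
`w_i (Y_i - Y_i(0)) + ε_i u_i / (1 - p_i) - w_i ATT`. It is square integrable, centred given `λ_t`
(`LatentPanel.condExp_influence`) and, given `λ_t`, i.i.d. over individuals. Under almost every
conditional law given `λ_t` the classical central limit theorem, the law of large numbers for the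
treated share and Slutsky's theorem apply (`condAsympNormal_of_condIndep`). The remainder vanishes in
probability only unconditionally. Along a subsequence it vanishes almost surely, hence almost surely
under almost every conditional law, and this is enough for a conclusion in probability.
-/

/-! ### Conditional independence and conditional laws -/

section CondIndependence

variable {Ω : Type*}

/-- The sets `A ∩ B` with `A` in the first and `B` in the second σ-algebra generate the join. -/
lemma generateFrom_inter_eq_sup (m₁ m₂ : MeasurableSpace Ω) :
    m₁ ⊔ m₂ = MeasurableSpace.generateFrom
      {s | ∃ A B, MeasurableSet[m₁] A ∧ MeasurableSet[m₂] B ∧ s = A ∩ B} := by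
  apply le_antisymm
  · refine sup_le (fun A hA => ?_) (fun B hB => ?_)
    · exact MeasurableSpace.measurableSet_generateFrom
        ⟨A, Set.univ, hA, MeasurableSet.univ, (Set.inter_univ A).symm⟩
    · exact MeasurableSpace.measurableSet_generateFrom
        ⟨Set.univ, B, MeasurableSet.univ, hB, (Set.univ_inter B).symm⟩
  · refine MeasurableSpace.generateFrom_le ?_
    rintro _ ⟨A, B, hA, hB, rfl⟩
    exact MeasurableSet.inter ((le_sup_left : m₁ ≤ m₁ ⊔ m₂) _ hA)
      ((le_sup_right : m₂ ≤ m₁ ⊔ m₂) _ hB)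

lemma isPiSystem_inter_of_measurableSet (m₁ m₂ : MeasurableSpace Ω) :
    IsPiSystem {s | ∃ A B, MeasurableSet[m₁] A ∧ MeasurableSet[m₂] B ∧ s = A ∩ B} := by
  rintro _ ⟨A, B, hA, hB, rfl⟩ _ ⟨A', B', hA', hB', rfl⟩ _
  exact ⟨A ∩ A', B ∩ B', hA.inter hA', hB.inter hB', by ext; simp; tauto⟩

variable {m m₁ m₂ : MeasurableSpace Ω} [mΩ : MeasurableSpace Ω] {μ : Measure Ω}

/-- Two set integrals agree on a join of σ-algebras as soon as they agree on the intersections of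
their members. -/
lemma setIntegral_eq_of_forall_inter {f g : Ω → ℝ} (hm₁ : m₁ ≤ mΩ) (hm₂ : m₂ ≤ mΩ)
    (hf : Integrable f μ) (hg : Integrable g μ)
    (h : ∀ A B, MeasurableSet[m₁] A → MeasurableSet[m₂] B →
      ∫ ω in A ∩ B, f ω ∂μ = ∫ ω in A ∩ B, g ω ∂μ) {s : Set Ω} (hs : MeasurableSet[m₁ ⊔ m₂] s) :
    ∫ ω in s, f ω ∂μ = ∫ ω in s, g ω ∂μ := by
  have hle : m₁ ⊔ m₂ ≤ mΩ := sup_le hm₁ hm₂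
  have huniv : ∫ ω, f ω ∂μ = ∫ ω, g ω ∂μ := by
    simpa using h Set.univ Set.univ MeasurableSet.univ MeasurableSet.univ
  induction s, hs using MeasurableSpace.induction_on_inter (generateFrom_inter_eq_sup m₁ m₂)
    (isPiSystem_inter_of_measurableSet m₁ m₂) with
  | empty => simp
  | basic s hs =>
    obtain ⟨A, B, hA, hB, rfl⟩ := hs
    exact h A B hA hB
  | compl s hs ih =>
    have h1 := integral_add_compl (hle _ hs) hf
    have h2 := integral_add_compl (hle _ hs) hg
    linarith
  | iUnion t hd ht ih =>
    rw [integral_iUnion (fun i => hle _ (ht i)) hd hf.integrableOn,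
      integral_iUnion (fun i => hle _ (ht i)) hd hg.integrableOn]
    exact tsum_congr ih

/-- A conditional expectation given `l` depends only on the joint law with `l`. -/
lemma condExp_ae_eq_of_map_prod_eq {L : Type*} [MeasurableSpace L] {l : Ω → L} {X Y : Ω → ℝ}
    [IsFiniteMeasure μ] (hl : Measurable l)
    (h : IdentDistrib (fun ω => (l ω, X ω)) (fun ω => (l ω, Y ω)) μ μ) (hX : Integrable X μ) :
    μ[X | MeasurableSpace.comap l inferInstance] =ᵐ[μ]
      μ[Y | MeasurableSpace.comap l inferInstance] := by
  have hY : Integrable Y μ := (h.comp measurable_snd).integrable_iff.1 hX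
  refine ae_eq_condExp_of_forall_setIntegral_eq hl.comap_le hY
    (fun s _ _ => integrable_condExp.integrableOn) ?_ stronglyMeasurable_condExp.aestronglyMeasurable
  rintro _ ⟨A, hA, rfl⟩ -
  rw [setIntegral_condExp hl.comap_le hX ⟨A, hA, rfl⟩, ← integral_indicator (hl hA),
    ← integral_indicator (hl hA)]
  have hm : Measurable fun z : L × ℝ => (Prod.fst ⁻¹' A).indicator Prod.snd z :=
    measurable_snd.indicator (measurable_fst hA)
  exact (h.comp hm).integral_eq

variable [StandardBorelSpace Ω] [IsFiniteMeasure μ]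

/-- If `m₁` and `m₂` are conditionally independent given `m`, then knowing `m₁` in addition to `m`
does not change the conditional probability of a set of `m₂`. -/
lemma ProbabilityTheory.CondIndep.condExp_indicator_sup (hm : m ≤ mΩ) (hm₁ : m₁ ≤ mΩ)
    (hm₂ : m₂ ≤ mΩ)
    (h : CondIndep m m₁ m₂ hm μ) {B : Set Ω} (hB : MeasurableSet[m₂] B) :
    μ⟦B | m ⊔ m₁⟧ =ᵐ[μ] μ⟦B | m⟧ := by
  have hle : m ⊔ m₁ ≤ mΩ := sup_le hm hm₁
  have hBi : Integrable (B.indicator fun _ => (1 : ℝ)) μ :=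
    (integrable_const _).indicator (hm₂ _ hB)
  symm
  refine ae_eq_condExp_of_forall_setIntegral_eq hle hBi (fun s _ _ => integrable_condExp.integrableOn)
    (fun s hs _ => ?_)
    ((stronglyMeasurable_condExp (m := m)).mono (le_sup_left : m ≤ m ⊔ m₁)).aestronglyMeasurable
  refine setIntegral_eq_of_forall_inter hm hm₁ integrable_condExp hBi (fun A C hA hC => ?_) hs
  have hAC : ∀ f : Ω → ℝ, ∫ ω in A ∩ C, f ω ∂μ = ∫ ω in A, C.indicator f ω ∂μ := fun f => by
    rw [setIntegral_indicator (hm₁ _ hC)]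
  have hCi : Integrable (C.indicator fun _ => (1 : ℝ)) μ :=
    (integrable_const _).indicator (hm₁ _ hC)
  have hprod := (condIndep_iff m m₁ m₂ hm hm₁ hm₂ μ).1 h C B hC hB
  have e1 : C.indicator (μ⟦B | m⟧) = (C.indicator fun _ => (1 : ℝ)) * μ⟦B | m⟧ := by
    ext ω; by_cases hω : ω ∈ C <;> simp [hω]
  have e2 : C.indicator (B.indicator fun _ => (1 : ℝ)) = (C ∩ B).indicator fun _ => (1 : ℝ) :=
    Set.indicator_indicator _ _ _
  have hint : Integrable ((C.indicator fun _ => (1 : ℝ)) * μ⟦B | m⟧) μ := by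
    rw [← e1]; exact integrable_condExp.indicator (hm₁ _ hC)
  rw [hAC, hAC, e1, e2, ← setIntegral_condExp hm hint hA,
    ← setIntegral_condExp hm ((integrable_const (1 : ℝ)).indicator
      ((hm₁ _ hC).inter (hm₂ _ hB))) hA]
  refine setIntegral_congr_ae (hm _ hA) ?_
  filter_upwards [hprod, condExp_mul_of_stronglyMeasurable_right
    (stronglyMeasurable_condExp (μ := μ) (m := m) (f := B.indicator fun _ => (1 : ℝ)))
    hint hCi] with ω h1 h2 _
  rw [h2, h1]

/-- A variable that is centred given `m`, and conditionally independent of `m₂` given `m`, is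
orthogonal to everything that is known from `m` and `m₂`. -/
lemma ProbabilityTheory.CondIndep.integral_mul_eq_zero (hm : m ≤ mΩ) (hm₁ : m₁ ≤ mΩ)
    (hm₂ : m₂ ≤ mΩ)
    (h : CondIndep m m₁ m₂ hm μ) {f Z : Ω → ℝ} (hf : StronglyMeasurable[m₁] f)
    (hfi : Integrable f μ) (hf0 : μ[f | m] =ᵐ[μ] 0) (hZ : StronglyMeasurable[m ⊔ m₂] Z)
    (hZf : Integrable (Z * f) μ) : ∫ ω, Z ω * f ω ∂μ = 0 := by
  have hle₂ : m ⊔ m₂ ≤ mΩ := sup_le hm hm₂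
  have hle₁ : m ⊔ m₁ ≤ mΩ := sup_le hm hm₁
  have hcond : μ[f | m ⊔ m₂] =ᵐ[μ] 0 := by
    symm
    refine ae_eq_condExp_of_forall_setIntegral_eq hle₂ hfi (fun s _ _ => by simp [IntegrableOn])
      (fun s hs _ => ?_) aestronglyMeasurable_zero
    refine setIntegral_eq_of_forall_inter hm hm₂ (integrable_zero _ _ _) hfi
      (fun A B hA hB => ?_) hs
    have e1 : B.indicator f = f * (B.indicator fun _ => (1 : ℝ)) := by
      ext ω; by_cases hω : ω ∈ B <;> simp [hω]
    have hBi : Integrable (B.indicator fun _ => (1 : ℝ)) μ :=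
      (integrable_const _).indicator (hm₂ _ hB)
    have hi1 : Integrable (f * (B.indicator fun _ => (1 : ℝ))) μ := by
      rw [← e1]; exact hfi.indicator (hm₂ _ hB)
    have hb : ∀ᵐ ω ∂μ, ‖(μ⟦B | m⟧) ω‖ ≤ 1 :=
      ae_bdd_abs_condExp_of_ae_bdd_abs (R := 1) (ae_of_all _ fun ω => by
        by_cases hω : ω ∈ B <;> simp [hω])
    have hi2 : Integrable (f * μ⟦B | m⟧) μ := by
      refine hfi.mul_bdd (c := 1) ?_ ?_
      · exact integrable_condExp.aestronglyMeasurable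
      · exact hb
    simp only [Pi.zero_apply, integral_zero]
    rw [← setIntegral_indicator (hm₂ _ hB), e1,
      ← setIntegral_condExp hle₁ hi1 ((le_sup_left : m ≤ m ⊔ m₁) _ hA)]
    have s1 : μ[f * (B.indicator fun _ => (1 : ℝ)) | m ⊔ m₁] =ᵐ[μ] f * μ⟦B | m⟧ :=
      (condExp_mul_of_stronglyMeasurable_left (hf.mono (le_sup_right : m₁ ≤ m ⊔ m₁)) hi1 hBi).trans
        (EventuallyEq.rfl.mul (h.condExp_indicator_sup hm hm₁ hm₂ hB))
    rw [setIntegral_congr_ae (g := f * μ⟦B | m⟧) (hm _ hA) (s1.mono fun ω hω _ => hω),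
      ← setIntegral_condExp hm hi2 hA]
    symm
    rw [setIntegral_congr_ae (g := 0) (hm _ hA)]
    · simp
    filter_upwards [condExp_mul_of_stronglyMeasurable_right
      (stronglyMeasurable_condExp (μ := μ) (m := m) (f := B.indicator fun _ => (1 : ℝ)))
      hi2 hfi, hf0] with ω h1 h2 _
    rw [h1, Pi.mul_apply, h2]
    simp
  have := integral_condExp (μ := μ) hle₂ (f := Z * f)
  rw [Pi.mul_def] at this
  rw [← this, integral_congr_ae (g := 0)]
  · simp
  filter_upwards [condExp_mul_of_stronglyMeasurable_left hZ hZf hfi, hcond] with ω h1 h2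
  rw [← Pi.mul_def, h1, Pi.mul_apply, h2]
  simp

/-- Conditional independence given `m` is not affected by adding `m` to each σ-algebra. -/
lemma ProbabilityTheory.iCondIndep.sup_left {ι : Type*} (hm : m ≤ mΩ) {M : ι → MeasurableSpace Ω}
    (hM : ∀ i, M i ≤ mΩ) (h : iCondIndep m hm M μ) :
    iCondIndep m hm (fun i => m ⊔ M i) μ := by
  refine iCondIndepSets.iCondIndep (hm' := hm) (fun i => m ⊔ M i) (fun i => sup_le hm (hM i))
    (fun i => {s | ∃ A B, MeasurableSet[m] A ∧ MeasurableSet[M i] B ∧ s = A ∩ B})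
    (fun i => isPiSystem_inter_of_measurableSet _ _)
    (fun i => generateFrom_inter_eq_sup _ _) ?_
  rw [iCondIndepSets_iff]
  · intro S f hf
    choose! A B hA hB hAB using hf
    have hprod := (iCondIndep_iff m hm M hM μ).1 h S hB
    have key : ∀ C D : Set Ω, MeasurableSet[m] C → MeasurableSet D →
        μ⟦C ∩ D | m⟧ =ᵐ[μ] C.indicator (μ⟦D | m⟧) := fun C D hC hD => by
      have := condExp_indicator (μ := μ) (m := m)
        ((integrable_const (1 : ℝ)).indicator hD) hC
      rwa [Set.indicator_indicator] at this
    have e : (⋂ i ∈ S, f i) = (⋂ i ∈ S, A i) ∩ ⋂ i ∈ S, B i := by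
      rw [Set.iInter₂_congr hAB]
      ext ω; simp [forall_and]
    have k1 := key (⋂ i ∈ S, A i) (⋂ i ∈ S, B i)
      (MeasurableSet.biInter S.countable_toSet fun i hi => hA i hi)
      (MeasurableSet.biInter S.countable_toSet fun i hi => hM i _ (hB i hi))
    have k2 : ∀ᵐ ω ∂μ, ∀ i ∈ S, (μ⟦f i | m⟧) ω = (A i).indicator (μ⟦B i | m⟧) ω := by
      refine (ae_ball_iff S.countable_toSet).2 fun i hi => ?_
      have := key (A i) (B i) (hA i hi) (hM i _ (hB i hi))
      rw [hAB i hi]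
      exact this
    rw [e]
    filter_upwards [k1, k2, hprod] with ω h1 h2 h3
    rw [h1, Finset.prod_apply, Finset.prod_congr rfl h2]
    by_cases hω : ω ∈ ⋂ i ∈ S, A i
    · rw [Set.indicator_of_mem hω, h3, Finset.prod_apply]
      refine Finset.prod_congr rfl fun i hi => ?_
      rw [Set.indicator_of_mem (Set.mem_iInter₂.1 hω i hi)]
    · rw [Set.indicator_of_notMem hω]
      simp only [Set.mem_iInter, not_forall] at hω
      obtain ⟨i, hi, hω⟩ := hω
      rw [Finset.prod_eq_zero hi (Set.indicator_of_notMem hω _)]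
  · rintro i _ ⟨A, B, hA, hB, rfl⟩
    exact (hm _ hA).inter (hM i _ hB)

/-- Conditionally independent real variables are independent under almost every conditional
law. -/
lemma ProbabilityTheory.iCondIndepFun.ae_iIndepFun_condExpKernel {ι : Type*} [Countable ι]
    (hm : m ≤ mΩ)
    {X : ι → Ω → ℝ} (hX : ∀ i, Measurable (X i)) (h : iCondIndepFun m hm X μ) :
    ∀ᵐ ω ∂μ, iIndepFun X (condExpKernel μ m ω) := by
  have hk : ∀ᵐ ω ∂μ, ∀ (S : Finset ι) (q : S → ℚ),
      condExpKernel μ m ω (⋂ i : S, X i ⁻¹' Set.Iic (q i : ℝ)) =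
        ∏ i : S, condExpKernel μ m ω (X i ⁻¹' Set.Iic (q i : ℝ)) := by
    refine ae_all_iff.2 fun S => ae_all_iff.2 fun q => ?_
    classical
    have hk' := ae_of_ae_trim hm (Kernel.iIndepFun.meas_biInter h (S := S)
      (s := fun i => if hi : i ∈ S then X i ⁻¹' Set.Iic (q ⟨i, hi⟩ : ℝ) else ∅)
      fun i hi => ⟨Set.Iic (q ⟨i, hi⟩ : ℝ), measurableSet_Iic, by simp [hi]⟩)
    filter_upwards [hk'] with ω hω
    have e : (⋂ i ∈ S, if hi : i ∈ S then X i ⁻¹' Set.Iic (q ⟨i, hi⟩ : ℝ) else ∅) =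
        ⋂ i : S, X i ⁻¹' Set.Iic (q i : ℝ) := by
      ext ω'
      simp only [Set.mem_iInter, Subtype.forall]
      exact forall₂_congr fun i hi => by simp [hi]
    rw [e, ← Finset.prod_coe_sort] at hω
    rw [hω]
    exact Finset.prod_congr rfl fun i _ => by simp
  filter_upwards [hk] with ω hω
  refine iIndepSets.iIndep (m := fun i => MeasurableSpace.comap (X i) inferInstance)
    (fun i => (hX i).comap_le)
    (fun i => {s | ∃ q : ℚ, X i ⁻¹' Set.Iic (q : ℝ) = s}) ?_ ?_ ?_
  · rintro i _ ⟨q, rfl⟩ _ ⟨q', rfl⟩ _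
    exact ⟨min q q', by ext; simp⟩
  · intro i
    rw [(inferInstance : BorelSpace ℝ).measurable_eq, Real.borel_eq_generateFrom_Iic_rat,
      MeasurableSpace.comap_generateFrom]
    congr 1
    ext s
    simp [eq_comm]
  · rw [iIndepSets_iff]
    intro S f hf
    choose! q hq using hf
    have := hω S fun i => q i
    rw [Finset.prod_coe_sort S fun i => condExpKernel μ m ω (X i ⁻¹' Set.Iic (q i : ℝ))] at this
    rw [← Set.iInter₂_congr hq, ← Finset.prod_congr rfl fun i hi =>
      congrArg (condExpKernel μ m ω) (hq i hi), ← this]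
    congr 1
    ext ω'
    simp

/-- Real variables with the same conditional probabilities given `m` have the same law under almost
every conditional law. -/
lemma ae_identDistrib_condExpKernel (hm : m ≤ mΩ) {X Y : Ω → ℝ} (hX : Measurable X)
    (hY : Measurable Y)
    (h : ∀ s : Set ℝ, MeasurableSet s → μ⟦X ⁻¹' s | m⟧ =ᵐ[μ] μ⟦Y ⁻¹' s | m⟧) :
    ∀ᵐ ω ∂μ, IdentDistrib X Y (condExpKernel μ m ω) (condExpKernel μ m ω) := by
  have hk : ∀ᵐ ω ∂μ, ∀ q : ℚ, (condExpKernel μ m ω).real (X ⁻¹' Set.Iic (q : ℝ)) =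
      (condExpKernel μ m ω).real (Y ⁻¹' Set.Iic (q : ℝ)) := by
    refine ae_all_iff.2 fun q => ?_
    filter_upwards [condExpKernel_ae_eq_condExp (μ := μ) hm (hX (measurableSet_Iic (a := (q : ℝ)))),
      condExpKernel_ae_eq_condExp (μ := μ) hm (hY (measurableSet_Iic (a := (q : ℝ)))),
      h _ (measurableSet_Iic (a := (q : ℝ)))] with ω h1 h2 h3
    rw [h1, h2, h3]
  filter_upwards [hk] with ω hω
  have hΩ : Nonempty Ω := ⟨ω⟩
  have := Measure.isProbabilityMeasure_map (μ := condExpKernel μ m ω) hX.aemeasurable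
  have := Measure.isProbabilityMeasure_map (μ := condExpKernel μ m ω) hY.aemeasurable
  refine ⟨hX.aemeasurable, hY.aemeasurable, ?_⟩
  refine ext_of_generate_finite _
    ((inferInstance : BorelSpace ℝ).measurable_eq.trans Real.borel_eq_generateFrom_Iic_rat)
    Real.isPiSystem_Iic_rat
    (fun s hs => ?_) (by simp)
  obtain ⟨q, rfl⟩ : ∃ q : ℚ, Set.Iic (q : ℝ) = s := by simpa [eq_comm] using hs
  rw [Measure.map_apply hX measurableSet_Iic, Measure.map_apply hY measurableSet_Iic]
  exact (measureReal_eq_measureReal_iff).1 (hω q)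

/-- What holds almost surely holds almost surely under almost every conditional law. -/
lemma ae_ae_condExpKernel_of_ae (hm : m ≤ mΩ) {p : Ω → Prop} (h : ∀ᵐ ω ∂μ, p ω) :
    ∀ᵐ ω ∂μ, ∀ᵐ ω' ∂(condExpKernel μ m ω), p ω' := by
  rw [← condExpKernel_comp_trim (μ := μ) hm] at h
  exact ae_of_ae_trim hm (Measure.ae_ae_of_ae_comp h)

lemma ae_of_ae_ae_condExpKernel (hm : m ≤ mΩ) {p : Ω → Prop} (hp : MeasurableSet {ω | p ω})
    (h : ∀ᵐ ω ∂μ, ∀ᵐ ω' ∂(condExpKernel μ m ω), p ω') : ∀ᵐ ω ∂μ, p ω := by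
  rw [← condExpKernel_comp_trim (μ := μ) hm, Measure.ae_comp_iff hp]
  rw [ae_iff] at h ⊢
  rw [trim_measurableSet_eq hm]
  · exact h
  · exact (measurable_condExpKernel hp.compl (measurableSet_singleton 0)).compl

end CondIndependence

/-! ### A conditional central limit theorem -/

section CentralLimit

variable {Ω : Type*} {m : MeasurableSpace Ω} [mΩ : MeasurableSpace Ω]

lemma MeasureTheory.TendstoInDistribution.comp_tendsto {Ω' : Type*} [MeasurableSpace Ω']
    {P : Measure Ω} [IsProbabilityMeasure P]
    {Q : Measure Ω'} [IsProbabilityMeasure Q] {X : ℕ → Ω → ℝ} {Z : Ω' → ℝ}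
    (h : TendstoInDistribution X atTop Z (fun _ => P) Q) {ns : ℕ → ℕ} (hns : Tendsto ns atTop atTop) :
    TendstoInDistribution (fun n => X (ns n)) atTop Z (fun _ => P) Q where
  forall_aemeasurable n := h.forall_aemeasurable (ns n)
  aemeasurable_limit := h.aemeasurable_limit
  tendsto := h.tendsto.comp hns

/-- Central limit theorem for the ratio of the sum of a centred i.i.d. sequence and the sum of
an i.i.d. sequence of nonzero mean. -/
lemma tendstoInDistribution_sum_div_sum {P : Measure Ω} [IsProbabilityMeasure P]
    {X W : ℕ → Ω → ℝ} (hX : MemLp (X 0) 2 P) (hXi : iIndepFun X P)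
    (hXd : ∀ i, IdentDistrib (X i) (X 0) P P) (hX0 : ∫ ω, X 0 ω ∂P = 0)
    (hW : ∀ i, AEMeasurable (W i) P)
    {π : ℝ} (hπ : π ≠ 0)
    (hWlim : ∀ᵐ ω ∂P, Tendsto (fun n : ℕ => (∑ i ∈ Finset.range n, W i ω) / n) atTop (𝓝 π)) :
    TendstoInDistribution (fun (n : ℕ) ω => ((√n)⁻¹ * ∑ i ∈ Finset.range n, X i ω) *
        ((∑ i ∈ Finset.range n, W i ω) / n)⁻¹) atTop id (fun _ => P)
      (gaussianReal 0 ((∫ ω, X 0 ω ^ 2 ∂P) / π ^ 2).toNNReal) := by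
  have hvar : Var[X 0; P] = ∫ ω, X 0 ω ^ 2 ∂P := by
    rw [variance_eq_integral hX.aemeasurable, hX0]; simp
  have hclt := tendstoInDistribution_inv_sqrt_mul_sum_sub (Y := id)
    (P' := gaussianReal 0 Var[X 0; P].toNNReal) HasLaw.id hX hXi hXd
  simp only [hX0, mul_zero, sub_zero] at hclt
  have hWm : TendstoInMeasure P (fun (n : ℕ) ω => ((∑ i ∈ Finset.range n, W i ω) / n)⁻¹) atTop
      fun _ => π⁻¹ := by
    refine tendstoInMeasure_of_tendsto_ae (fun n => ?_) ?_
    · have : AEMeasurable (fun ω => ∑ i ∈ Finset.range n, W i ω) P :=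
        Finset.aemeasurable_fun_sum _ fun i _ => hW i
      exact (this.div_const _).inv.aestronglyMeasurable
    · filter_upwards [hWlim] with ω hω using hω.inv₀ hπ
  have hs := hclt.continuous_comp_prodMk_of_tendstoInMeasure_const
    (g := fun x : ℝ × ℝ => x.1 * x.2) (by fun_prop) hWm (fun n => by
      have : AEMeasurable (fun ω => ∑ i ∈ Finset.range n, W i ω) P :=
        Finset.aemeasurable_fun_sum _ fun i _ => hW i
      exact (this.div_const _).inv)
  refine ⟨hs.forall_aemeasurable, by fun_prop, ?_⟩
  have hlaw : Measure.map id (gaussianReal 0 ((∫ ω, X 0 ω ^ 2 ∂P) / π ^ 2).toNNReal) =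
      Measure.map (fun ω => id ω * π⁻¹) (gaussianReal 0 Var[X 0; P].toNNReal) := by
    rw [Measure.map_id]
    simp only [id]
    rw [gaussianReal_map_mul_const, mul_zero]
    congr 1
    ext
    have h0 : 0 ≤ ∫ ω, X 0 ω ^ 2 ∂P := integral_nonneg fun ω => sq_nonneg _
    rw [hvar, Real.coe_toNNReal _ (by positivity), NNReal.coe_mul, Real.coe_toNNReal _ h0]
    simp [div_eq_inv_mul]
  have := hs.tendsto
  simpa only [hlaw] using this

lemma MeasureTheory.TendstoInDistribution.tendsto_integral {Ω' : Type*} [MeasurableSpace Ω']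
    {P : Measure Ω} [IsProbabilityMeasure P]
    {Q : Measure Ω'} [IsProbabilityMeasure Q] {X : ℕ → Ω → ℝ} {Z : Ω' → ℝ}
    (h : TendstoInDistribution X atTop Z (fun _ => P) Q) (f : ℝ →ᵇ ℝ) :
    Tendsto (fun n => ∫ ω, f (X n ω) ∂P) atTop (𝓝 (∫ ω, f (Z ω) ∂Q)) := by
  have := ProbabilityMeasure.tendsto_iff_forall_integral_tendsto.1 h.tendsto f
  simp only [ProbabilityMeasure.coe_mk] at this
  rw [integral_map h.aemeasurable_limit f.continuous.aestronglyMeasurable] at this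
  refine this.congr fun n => ?_
  rw [integral_map (h.forall_aemeasurable n) f.continuous.aestronglyMeasurable]

variable [StandardBorelSpace Ω]

/-- Conditional central limit theorem, stable under perturbations that vanish in probability. -/
lemma condAsympNormal_of_condIndep {P : Measure Ω} [IsProbabilityMeasure P]
    (hm : m ≤ mΩ) {X W S : ℕ → Ω → ℝ} {π V : Ω → ℝ}
    (hXm : ∀ i, Measurable (X i)) (hWm : ∀ i, Measurable (W i)) (hSm : ∀ N, Measurable (S N))
    (hX : MemLp (X 0) 2 P) (hXi : iCondIndepFun m hm X P)
    (hXd : ∀ i, ∀ s : Set ℝ, MeasurableSet s → P⟦X i ⁻¹' s | m⟧ =ᵐ[P] P⟦X 0 ⁻¹' s | m⟧)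
    (hX0 : P[X 0 | m] =ᵐ[P] 0)
    (hπ : ∀ᵐ ω ∂P, π ω ≠ 0)
    (hWlim : ∀ᵐ ω ∂P, ∀ᵐ ω' ∂(condExpKernel P m ω),
      Tendsto (fun n : ℕ => (∑ i ∈ Finset.range n, W i ω') / n) atTop (𝓝 (π ω)))
    (hV : V =ᵐ[P] fun ω => (P[fun ω => X 0 ω ^ 2 | m]) ω / π ω ^ 2)
    (hS : TendstoInMeasure P (fun N ω => S N ω - ((√N)⁻¹ * ∑ i ∈ Finset.range N, X i ω) *
        ((∑ i ∈ Finset.range N, W i ω) / N)⁻¹) atTop fun _ => 0) :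
    CondAsympNormal P m S V := by
  intro f
  rw [exists_seq_tendstoInMeasure_atTop_iff
    (fun n => integrable_condExp.aestronglyMeasurable)]
  intro ns hns
  -- Convergence in probability does not pass to the conditional laws, almost sure convergence does.
  obtain ⟨ns', hns', hae⟩ := (hS.comp hns.tendsto_atTop).exists_seq_tendsto_ae
  refine ⟨ns', hns', ?_⟩
  have hfS : ∀ N, Integrable (fun ω => f (S N ω)) P := fun N =>
    Integrable.of_bound (f.continuous.measurable.comp (hSm N)).aestronglyMeasurable ‖f‖
      (ae_of_all _ fun ω => f.norm_coe_le_norm _)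
  have hE : ∀ᵐ ω ∂P, ∀ N, (P[fun ω => f (S N ω) | m]) ω =
      ∫ ω', f (S N ω') ∂(condExpKernel P m ω) :=
    ae_all_iff.2 fun N => condExp_ae_eq_integral_condExpKernel hm (hfS N)
  have hd : ∀ᵐ ω ∂P, ∀ i, IdentDistrib (X i) (X 0) (condExpKernel P m ω) (condExpKernel P m ω) :=
    ae_all_iff.2 fun i => ae_identDistrib_condExpKernel hm (hXm i) (hXm 0) (hXd i)
  filter_upwards [hE, hd, hXi.ae_iIndepFun_condExpKernel hm hXm, hπ, hWlim, hV,
    condExp_ae_eq_integral_condExpKernel hm (hX.integrable one_le_two), hX0,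
    condExp_ae_eq_integral_condExpKernel hm hX.integrable_sq,
    hX.integrable_sq.condExpKernel_ae (m := m), ae_ae_condExpKernel_of_ae hm hae] with
    ω hE hd hi hπ hW hV hm0 hX0 hm2 hsq hae
  have hL2 : MemLp (X 0) 2 (condExpKernel P m ω) :=
    (memLp_two_iff_integrable_sq (hXm 0).aestronglyMeasurable).2 hsq
  have hclt := (tendstoInDistribution_sum_div_sum hL2 hi hd (by rw [← hm0, hX0]; rfl)
    (fun i => (hWm i).aemeasurable) hπ hW).comp_tendsto
      (hns.comp hns').tendsto_atTop
  have hYm : ∀ n : ℕ, Measurable fun ω => ((√n)⁻¹ * ∑ i ∈ Finset.range n, X i ω) *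
      ((∑ i ∈ Finset.range n, W i ω) / n)⁻¹ := fun n => by fun_prop
  have hadd := hclt.add_of_tendstoInMeasure_const (tendstoInMeasure_of_tendsto_ae
    (fun n => ((hSm _).sub (hYm _)).aestronglyMeasurable) hae)
    (fun n => ((hSm _).sub (hYm _)).aemeasurable)
  have := hadd.tendsto_integral f
  simp only [Pi.add_apply, Pi.sub_apply, Function.comp, add_sub_cancel, id, add_zero] at this
  rw [← hm2, ← hV] at this
  exact this.congr fun n => (hE _).symm

end CentralLimit

/-! ### Second moments of sums over conditionally independent families -/

section SecondMoment

variable {Ω : Type*} {m : MeasurableSpace Ω} [mΩ : MeasurableSpace Ω] {P : Measure Ω}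

lemma MeasureTheory.MemLp.of_abs_mul_le {Z e : Ω → ℝ} {B : ℝ} (he : MemLp e 2 P)
    (hZ : Measurable Z) (hB : ∀ᵐ ω ∂P, |Z ω| ≤ B) : MemLp (fun ω => Z ω * e ω) 2 P := by
  refine MemLp.of_le_mul (c := B) he (hZ.aestronglyMeasurable.mul he.1) ?_
  filter_upwards [hB] with ω hω
  rw [norm_mul]
  exact mul_le_mul_of_nonneg_right hω (norm_nonneg _)

/-- Bounded coefficients times orthogonal square-integrable variables: the second moment of the sum
is at most the number of terms times the bound of a single one. -/
lemma lintegral_sq_sum_mul_le {ι : Type*} (S : Finset ι) {Z e : ι → Ω → ℝ} {B D : ℝ}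
    (hZ : ∀ i ∈ S, Measurable (Z i)) (hB : ∀ i ∈ S, ∀ᵐ ω ∂P, |Z i ω| ≤ B)
    (he : ∀ i ∈ S, MemLp (e i) 2 P) (hD : ∀ i ∈ S, ∫ ω, e i ω ^ 2 ∂P ≤ D)
    (horth : ∀ i ∈ S, ∀ j ∈ S, i ≠ j → ∫ ω, Z i ω * (Z j ω * e j ω) * e i ω ∂P = 0) :
    ∫⁻ ω, ENNReal.ofReal ((∑ i ∈ S, Z i ω * e i ω) ^ 2) ∂P ≤
      ENNReal.ofReal (S.card * (B ^ 2 * D)) := by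
  have hZe : ∀ i ∈ S, MemLp (fun ω => Z i ω * e i ω) 2 P := fun i hi =>
    (he i hi).of_abs_mul_le (hZ i hi) (hB i hi)
  have hint : ∀ i ∈ S, ∀ j ∈ S, Integrable (fun ω => (Z i ω * e i ω) * (Z j ω * e j ω)) P :=
    fun i hi j hj => (hZe i hi).integrable_mul (hZe j hj)
  have hsum : MemLp (fun ω => ∑ i ∈ S, Z i ω * e i ω) 2 P := memLp_finsetSum S hZe
  rw [← ofReal_integral_eq_lintegral_ofReal hsum.integrable_sq (ae_of_all _ fun ω => sq_nonneg _)]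
  refine ENNReal.ofReal_le_ofReal ?_
  simp_rw [pow_two (∑ i ∈ S, _), Finset.sum_mul_sum]
  rw [integral_finsetSum _ fun i hi => integrable_finsetSum _ fun j hj => hint i hi j hj]
  rw [← nsmul_eq_mul]
  refine Finset.sum_le_card_nsmul _ _ _ fun i hi => ?_
  rw [integral_finsetSum _ fun j hj => hint i hi j hj, Finset.sum_eq_single_of_mem i hi]
  · calc ∫ ω, Z i ω * e i ω * (Z i ω * e i ω) ∂P ≤ ∫ ω, B ^ 2 * e i ω ^ 2 ∂P := by
          refine integral_mono_ae (hint i hi i hi) ((he i hi).integrable_sq.const_mul _) ?_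
          filter_upwards [hB i hi] with ω hω
          have : Z i ω ^ 2 ≤ B ^ 2 := sq_le_sq' (by linarith [(abs_le.1 hω).1]) (abs_le.1 hω).2
          calc Z i ω * e i ω * (Z i ω * e i ω) = Z i ω ^ 2 * e i ω ^ 2 := by ring
            _ ≤ B ^ 2 * e i ω ^ 2 := by gcongr
      _ = B ^ 2 * ∫ ω, e i ω ^ 2 ∂P := integral_const_mul _ _
      _ ≤ B ^ 2 * D := by gcongr; exact hD i hi
  · intro j hj hji
    rw [← horth i hi j hj hji.symm]
    exact integral_congr_ae (ae_of_all _ fun ω => by ring)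

/-- The `σ`-algebra generated by `m` and by all members of the family `e` but `e x`. -/
abbrev sigmaExcept {ι : Type*} (m : MeasurableSpace Ω) (e : ι → Ω → ℝ) (x : ι) : MeasurableSpace Ω :=
  m ⊔ ⨆ y ∈ ({x}ᶜ : Set ι), MeasurableSpace.comap (e y) inferInstance

omit [MeasurableSpace Ω] in
lemma le_sigmaExcept {ι : Type*} (m : MeasurableSpace Ω) (e : ι → Ω → ℝ) (x : ι) :
    m ≤ sigmaExcept m e x := le_sup_left

omit [MeasurableSpace Ω] in
lemma measurable_sigmaExcept {ι : Type*} (m : MeasurableSpace Ω) (e : ι → Ω → ℝ) {x y : ι}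
    (hxy : y ≠ x) : Measurable[sigmaExcept m e x] (e y) :=
  Measurable.mono (comap_measurable (e y))
    ((le_iSup₂_of_le (f := fun y (_ : y ∈ ({x}ᶜ : Set ι)) =>
      MeasurableSpace.comap (e y) inferInstance) y hxy le_rfl).trans
      (le_sup_right (a := m))) le_rfl

variable [IsProbabilityMeasure P] [StandardBorelSpace Ω]

/-- A conditionally centred member of a conditionally independent family is orthogonal to
everything that is known from the conditioning σ-algebra and the other members. -/
lemma integral_mul_eq_zero_of_iCondIndepFun {ι : Type*} (hm : m ≤ mΩ) {e : ι → Ω → ℝ}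
    (hem : ∀ x, Measurable (e x)) (he : iCondIndepFun m hm e P) {x : ι} (hi : Integrable (e x) P)
    (h0 : P[e x | m] =ᵐ[P] 0) {Z : Ω → ℝ} (hZ : Measurable[sigmaExcept m e x] Z)
    (hZe : Integrable (fun ω => Z ω * e x ω) P) : ∫ ω, Z ω * e x ω ∂P = 0 := by
  have hle : ∀ y, MeasurableSpace.comap (e y) inferInstance ≤ mΩ := fun y => (hem y).comap_le
  have hci := condIndep_iSup_of_disjoint hle ((iCondIndepFun_iff_iCondIndep ..).1 he)
    (disjoint_compl_right (a := ({x} : Set ι)))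
  rw [iSup_singleton] at hci
  exact hci.integral_mul_eq_zero hm (hle x) (iSup₂_le fun y _ => hle y)
    (comap_measurable (e x)).stronglyMeasurable hi h0 hZ.stronglyMeasurable hZe

/-- The second-moment bound for a sum over a conditionally independent family, when the
coefficients are known without the members that enter the sum. -/
lemma lintegral_sq_sum_le_of_iCondIndepFun {ι κ : Type*} (hm : m ≤ mΩ)
    {e : ι → Ω → ℝ}
    (hem : ∀ x, Measurable (e x)) (he : iCondIndepFun m hm e P) (hL2 : ∀ x, MemLp (e x) 2 P)
    (h0 : ∀ x, P[e x | m] =ᵐ[P] 0) {D : ℝ} (hD : ∀ x, ∫ ω, e x ω ^ 2 ∂P ≤ D)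
    (S : Finset κ) {x : κ → ι} (hx : Function.Injective x) {Z : κ → Ω → ℝ} {B : ℝ}
    (hB : ∀ i ∈ S, ∀ᵐ ω ∂P, |Z i ω| ≤ B)
    (hZ : ∀ i ∈ S, ∀ j ∈ S, Measurable[sigmaExcept m e (x j)] (Z i)) :
    ∫⁻ ω, ENNReal.ofReal ((∑ i ∈ S, Z i ω * e (x i) ω) ^ 2) ∂P ≤
      ENNReal.ofReal (S.card * (B ^ 2 * D)) := by
  have hle : ∀ y, sigmaExcept m e y ≤ mΩ := fun y =>
    sup_le hm (iSup₂_le fun z _ => (hem z).comap_le)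
  have hZm : ∀ i ∈ S, Measurable (Z i) := fun i hi => (hZ i hi i hi).mono (hle _) le_rfl
  have hZe : ∀ i ∈ S, MemLp (fun ω => Z i ω * e (x i) ω) 2 P := fun i hi =>
    (hL2 _).of_abs_mul_le (hZm i hi) (hB i hi)
  refine lintegral_sq_sum_mul_le S hZm hB (fun i _ => hL2 _) (fun i _ => hD _)
    fun i hi j hj hij => ?_
  refine integral_mul_eq_zero_of_iCondIndepFun hm hem he ((hL2 _).integrable one_le_two) (h0 _)
    (Z := fun ω => Z i ω * (Z j ω * e (x j) ω)) ?_ ?_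
  · exact (hZ i hi i hi).mul ((hZ j hj i hi).mul
      (measurable_sigmaExcept m e fun h => hij (hx h).symm))
  · refine ((hZe i hi).integrable_mul (hZe j hj)).congr (ae_of_all _ fun ω => ?_)
    simp only [Pi.mul_apply]
    ring

lemma ProbabilityTheory.HasCondSubgaussianMGF.integral_exp_mul_le {hm : m ≤ mΩ} {X : Ω → ℝ}
    {δ : ℝ≥0}
    (h : HasCondSubgaussianMGF m hm X δ P) (s : ℝ) :
    ∫ ω, Real.exp (s * X ω) ∂P ≤ Real.exp (δ * s ^ 2 / 2) := by
  rw [← integral_condExp hm]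
  calc _ ≤ ∫ _, Real.exp (δ * s ^ 2 / 2) ∂P :=
        integral_mono_ae integrable_condExp (integrable_const _) (h.ae_condExp_le s)
    _ = _ := by simp

lemma sq_le_exp_add_exp_neg (x : ℝ) : x ^ 2 ≤ 2 * (Real.exp (1 * x) + Real.exp (-1 * x)) := by
  have h := Real.quadratic_le_exp_of_nonneg (abs_nonneg x)
  rw [sq_abs] at h
  have h0 := abs_nonneg x
  rcases abs_cases x with ⟨hx, -⟩ | ⟨hx, -⟩ <;> rw [hx] at h h0 <;> simp only [one_mul, neg_mul]
  · linarith [Real.exp_pos (-x)]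
  · linarith [Real.exp_pos x]

lemma ProbabilityTheory.HasCondSubgaussianMGF.memLp_two {hm : m ≤ mΩ} {X : Ω → ℝ} {δ : ℝ≥0}
    (hX : Measurable X) (h : HasCondSubgaussianMGF m hm X δ P) : MemLp X 2 P := by
  rw [memLp_two_iff_integrable_sq hX.aestronglyMeasurable]
  refine (((h.integrable_exp_mul 1).add (h.integrable_exp_mul (-1))).const_mul 2).mono'
    (hX.pow_const 2).aestronglyMeasurable (ae_of_all _ fun ω => ?_)
  rw [Real.norm_of_nonneg (sq_nonneg _)]
  exact sq_le_exp_add_exp_neg _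

lemma ProbabilityTheory.HasCondSubgaussianMGF.integral_sq_le {hm : m ≤ mΩ} {X : Ω → ℝ} {δ : ℝ≥0}
    (hX : Measurable X) (h : HasCondSubgaussianMGF m hm X δ P) :
    ∫ ω, X ω ^ 2 ∂P ≤ 4 * Real.exp (δ / 2) := by
  calc ∫ ω, X ω ^ 2 ∂P ≤ ∫ ω, 2 * (Real.exp (1 * X ω) + Real.exp (-1 * X ω)) ∂P :=
        integral_mono_ae (h.memLp_two hX).integrable_sq
          (((h.integrable_exp_mul 1).add (h.integrable_exp_mul (-1))).const_mul 2)
          (ae_of_all _ fun ω => sq_le_exp_add_exp_neg _)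
    _ ≤ 4 * Real.exp (δ / 2) := by
        rw [integral_const_mul, integral_add (h.integrable_exp_mul 1) (h.integrable_exp_mul (-1))]
        have h1 := h.integral_exp_mul_le 1
        have h2 := h.integral_exp_mul_le (-1)
        norm_num at h1 h2 ⊢
        linarith

end SecondMoment

/-! ### The panel and its nuisance estimates -/

section Panel

lemma measurable_finset_sup {Ω ι : Type*} {_ : MeasurableSpace Ω} (S : Finset ι) {f : ι → Ω → ℝ≥0}
    (hf : ∀ i ∈ S, Measurable (f i)) : Measurable fun ω => S.sup fun i => f i ω := by
  classical
  induction S using Finset.induction_on with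
  | empty => simp
  | insert i S _ ih =>
    simp only [Finset.sup_insert]
    exact (hf i (Finset.mem_insert_self i S)).sup
      (ih fun j hj => hf j (Finset.mem_insert_of_mem hj))

variable {Ω : Type*} {𝓜 : MeasurableSpace Ω} [mΩ : MeasurableSpace Ω] {L : Type*} 
  [MeasurableSpace L] {d J b : ℕ}

namespace LatentPanel

/-- The panel in which the untreated potential outcomes are observed throughout. Its nuisance
estimates agree almost surely with those of the original panel, and they are functions of the latent
factors and the errors alone. -/
noncomputable def untreated (M : LatentPanel Ω L d) : LatentPanel Ω L d :=
  { M with Y := M.Y0, measurable_Y := M.measurable_Y0 }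

lemma measurable_μ0At_sigmaAll (M : LatentPanel Ω L d) (i : ℕ) (s : ℤ) :
    Measurable[M.sigmaAll] (M.μ0At i s) := by
  have h : Measurable fun z : (ℕ → EuclideanSpace ℝ (Fin d)) × (ℤ → L) =>
      M.μ0 (z.1 i) (z.2 s) :=
    M.measurable_μ0.comp (f := fun z : (ℕ → EuclideanSpace ℝ (Fin d)) × (ℤ → L) =>
      (z.1 i, z.2 s)) (((measurable_pi_apply i).comp measurable_fst).prodMk
      ((measurable_pi_apply s).comp measurable_snd))
  exact h.comp (comap_measurable _)

lemma measurable_pAt_sigmaAll (M : LatentPanel Ω L d) (i : ℕ) (s : ℤ) :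
    Measurable[M.sigmaAll] (M.pAt i s) := by
  have h : Measurable fun z : (ℕ → EuclideanSpace ℝ (Fin d)) × (ℤ → L) =>
      M.p s (z.1 i) (z.2 s) :=
    (M.measurable_p s).comp (f := fun z : (ℕ → EuclideanSpace ℝ (Fin d)) × (ℤ → L) =>
      (z.1 i, z.2 s)) (((measurable_pi_apply i).comp measurable_fst).prodMk
      ((measurable_pi_apply s).comp measurable_snd))
  exact h.comp (comap_measurable _)

lemma measurable_μ0At (M : LatentPanel Ω L d) (i : ℕ) (s : ℤ) : Measurable (M.μ0At i s) :=
  (M.measurable_μ0At_sigmaAll i s).mono M.sigmaAll_le le_rfl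

lemma measurable_pAt (M : LatentPanel Ω L d) (i : ℕ) (s : ℤ) : Measurable (M.pAt i s) :=
  (M.measurable_pAt_sigmaAll i s).mono M.sigmaAll_le le_rfl

lemma measurable_err (M : LatentPanel Ω L d) (t : ℤ) (x : ℕ × obsPeriods t × Bool) :
    Measurable (M.err t x) := by
  unfold err
  split_ifs
  · exact (M.measurable_Y0 _ _).sub (M.measurable_μ0At _ _)
  · exact (M.measurable_w _ _).sub (M.measurable_pAt _ _)

end LatentPanel

lemma mem_obsPeriods_self (t : ℤ) : t ∈ obsPeriods t := Or.inr rfl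

namespace CrossFitting

/-- The cross-fitting scheme with the deterministic partition `g` and the deterministic choice `k`
of the bandwidth, for all sample sizes. -/
def freeze (C : CrossFitting Ω J b) (g : ℕ → Fin J) (k : Fin b) : CrossFitting Ω J b :=
  { C with
    fold := fun _ _ => g
    sel := fun _ _ => k
    measurable_fold := fun _ => measurable_const
    measurable_sel := fun _ => measurable_const }

variable (C : CrossFitting Ω J b) (M : LatentPanel Ω L d) (K : ℝ≥0 → ℝ) (t : ℤ)

lemma otherFolds_freeze {N : ℕ} {ω : Ω} {g : ℕ → Fin J} (hg : ∀ j < N, g j = C.fold N ω j)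
    {i : ℕ} (hi : i < N) (k : Fin b) :
    (C.freeze g k).otherFolds N ω i = C.otherFolds N ω i := by
  refine Finset.filter_congr fun j hj => ?_
  simp only [freeze]
  rw [hg j (Finset.mem_range.1 hj), hg i hi]

lemma weight_freeze {N : ℕ} {ω : Ω} {g : ℕ → Fin J} (hg : ∀ j < N, g j = C.fold N ω j)
    {i : ℕ} (hi : i < N) (j : ℕ) :
    (C.freeze g (C.sel N ω)).weight M K N i j ω = C.weight M K N i j ω := by
  unfold weight pseudoDist
  rw [C.otherFolds_freeze hg hi]
  rfl

lemma muHat_freeze {N : ℕ} {ω : Ω} {g : ℕ → Fin J} (hg : ∀ j < N, g j = C.fold N ω j)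
    {i : ℕ} (hi : i < N) :
    (C.freeze g (C.sel N ω)).muHat M K t N i ω = C.muHat M K t N i ω := by
  unfold muHat
  simp only [C.otherFolds_freeze hg hi, C.weight_freeze M K hg hi]

lemma pHat_freeze {N : ℕ} {ω : Ω} {g : ℕ → Fin J} (hg : ∀ j < N, g j = C.fold N ω j)
    {i : ℕ} (hi : i < N) :
    (C.freeze g (C.sel N ω)).pHat M K t N i ω = C.pHat M K t N i ω := by
  unfold pHat
  simp only [C.otherFolds_freeze hg hi, C.weight_freeze M K hg hi]

lemma weight_untreated {ω : Ω} (h : ∀ l, ∀ s ≤ 0, M.Y l s ω = M.Y0 l s ω) (N i j : ℕ) :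
    C.weight M.untreated K N i j ω = C.weight M K N i j ω := by
  unfold weight pseudoDist
  congr 3
  refine Finset.sup_congr rfl fun l _ => ?_
  congr 1
  refine Finset.sum_congr rfl fun s hs => ?_
  have hs0 := (Finset.mem_Ioc.1 hs).2
  rw [h l s hs0, h i s hs0, h j s hs0]
  rfl

/-- The nuisance estimates use outcomes of untreated individuals and periods only. -/
lemma muHat_untreated {ω : Ω}
    (h : ∀ l, ∀ s ∈ obsPeriods t, M.w l s ω = 0 → M.Y l s ω = M.Y0 l s ω) (N i : ℕ) :
    C.muHat M.untreated K t N i ω = C.muHat M K t N i ω := by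
  have h' : ∀ l, ∀ s ≤ 0, M.Y l s ω = M.Y0 l s ω := fun l s hs =>
    h l s (Or.inl hs) (M.w_pre l s ω hs)
  unfold muHat
  simp only [C.weight_untreated M K h']
  congr 1
  refine Finset.sum_congr rfl fun j hj => ?_
  rw [h j t (mem_obsPeriods_self t) (Finset.mem_filter.1 hj).2]
  rfl

lemma pHat_untreated {ω : Ω} (h : ∀ l, ∀ s ≤ 0, M.Y l s ω = M.Y0 l s ω) (N i : ℕ) :
    C.pHat M.untreated K t N i ω = C.pHat M K t N i ω := by
  unfold pHat
  simp only [C.weight_untreated M K h]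
  rfl

section Measurability

variable {K} (g : ℕ → Fin J) (k : Fin b)

lemma measurable_weight_freeze (hK : Measurable K) (hY : ∀ l, ∀ s ≤ 0, Measurable[𝓜] (M.Y l s))
    (N i j : ℕ) : Measurable[𝓜] ((C.freeze g k).weight M K N i j) := by
  change Measurable[𝓜] fun ω => K ((C.freeze g k).pseudoDist M N i j ω / C.h N k)
  refine hK.comp (Measurable.div_const ?_ _)
  unfold pseudoDist
  refine Measurable.const_mul ?_ _
  refine measurable_finset_sup
    (((Finset.range N).filter fun j => g j ≠ g i).filter fun l => l ≠ i ∧ l ≠ j) fun l _ => ?_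
  refine measurable_nnnorm.comp ?_
  refine Finset.measurable_fun_sum _ fun s hs => ?_
  have hs0 := (Finset.mem_Ioc.1 hs).2
  exact (hY l s hs0).mul ((hY i s hs0).sub (hY j s hs0))

lemma measurable_pHat_freeze (hK : Measurable K) (hY : ∀ l, ∀ s ≤ 0, Measurable[𝓜] (M.Y l s))
    (N i : ℕ) (hw : ∀ j, g j ≠ g i → Measurable[𝓜] (M.w j t)) :
    Measurable[𝓜] ((C.freeze g k).pHat M K t N i) := by
  unfold pHat
  have hW := C.measurable_weight_freeze M g k hK hY N i
  refine Measurable.div ?_ ?_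
  · refine Finset.measurable_fun_sum ((Finset.range N).filter fun j => g j ≠ g i) fun j hj => ?_
    exact (hW j).mul (hw j (Finset.mem_filter.1 hj).2)
  · exact Finset.measurable_fun_sum ((Finset.range N).filter fun j => g j ≠ g i) fun j _ => hW j

lemma measurable_muHat_freeze (hK : Measurable K) (hY : ∀ l, ∀ s ≤ 0, Measurable[𝓜] (M.Y l s))
    (N i : ℕ) (hw : ∀ j, g j ≠ g i → Measurable[𝓜] (M.w j t))
    (hYt : ∀ j, g j ≠ g i → Measurable[𝓜] (M.Y j t)) :
    Measurable[𝓜] ((C.freeze g k).muHat M K t N i) := by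
  unfold muHat
  have hW := C.measurable_weight_freeze M g k hK hY N i
  simp only [Finset.sum_filter]
  refine Measurable.div ?_ ?_
  · refine Finset.measurable_fun_sum ((Finset.range N).filter fun j => g j ≠ g i) fun j hj => ?_
    have hj := (Finset.mem_filter.1 hj).2
    exact Measurable.ite ((hw j hj) (measurableSet_singleton 0)) ((hW j).mul (hYt j hj))
      measurable_const
  · refine Finset.measurable_fun_sum ((Finset.range N).filter fun j => g j ≠ g i) fun j hj => ?_
    have hj := (Finset.mem_filter.1 hj).2
    exact Measurable.ite ((hw j hj) (measurableSet_singleton 0)) (hW j) measurable_const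

end Measurability

end CrossFitting

/-! ### The expansion of the doubly robust score in the nuisance parameters -/

/-- The odds `p / (1 - p)`. -/
noncomputable def odds (p : ℝ) : ℝ := p / (1 - p)

/-- Truncation of `x` to `[-η, η]`, for `0 ≤ η`. -/
noncomputable def clip (η x : ℝ) : ℝ := max (-η) (min x η)

lemma measurable_odds : Measurable odds := by unfold odds; fun_prop

lemma measurable_clip (η : ℝ) : Measurable (clip η) := by unfold clip; fun_prop

lemma abs_clip_le {η : ℝ} (hη : 0 ≤ η) (x : ℝ) : |clip η x| ≤ η := by
  unfold clip
  exact abs_le.2 ⟨le_max_left _ _, max_le (by linarith) (min_le_right _ _)⟩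

lemma clip_of_abs_le {η x : ℝ} (h : |x| ≤ η) : clip η x = x := by
  unfold clip
  rw [min_eq_left (abs_le.1 h).2, max_eq_right (abs_le.1 h).1]

lemma abs_odds_sub_le {c p q : ℝ} (hc : 0 < c) (hp : p ≤ 1 - c) (hq : |q - p| ≤ c / 2) :
    |odds q - odds p| ≤ 2 / c ^ 2 * |q - p| := by
  have h1 : c / 2 ≤ 1 - q := by linarith [(abs_le.1 hq).2]
  have h2 : c ≤ 1 - p := by linarith
  have h3 : 0 < 1 - q := by linarith
  have h4 : 0 < 1 - p := by linarith
  have e : odds q - odds p = (q - p) / ((1 - q) * (1 - p)) := by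
    unfold odds; field_simp; ring
  rw [e, abs_div, abs_of_pos (mul_pos h3 h4), div_eq_mul_inv, mul_comm]
  refine mul_le_mul_of_nonneg_right ?_ (abs_nonneg _)
  rw [inv_le_comm₀ (mul_pos h3 h4) (by positivity), inv_div]
  calc c ^ 2 / 2 = c / 2 * c := by ring
    _ ≤ (1 - q) * (1 - p) := by gcongr

/-- The estimation error of the score splits into a term linear in the error of the untreated mean,
a term linear in the error of the propensity, and their product. -/
lemma drScore_sub_drScore {y w p m q n : ℝ} (hw : w = 0 ∨ w = 1) (hp : 1 - p ≠ 0)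
    (hq : 1 - q ≠ 0) :
    drScore y w q n - drScore y w p m = -((n - m) / (1 - p) * (w - p)) -
      (odds q - odds p) * (1 - w) * (y - m) + (1 - w) * ((n - m) * (odds q - odds p)) := by
  unfold drScore odds
  rcases hw with rfl | rfl <;> field_simp <;> ring

end Panel

/-! ### The linear terms for a fixed partition and bandwidth -/

section LinearTerms

variable {Ω : Type*} {𝓜 : MeasurableSpace Ω} [mΩ : MeasurableSpace Ω] {L : Type*}
  [MeasurableSpace L] {d J b : ℕ}

namespace LatentPanel

variable (M : LatentPanel Ω L d) (t : ℤ)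

lemma measurable_Y0_sigmaExcept {l : ℕ} {s : ℤ} (hs : s ∈ obsPeriods t)
    {x : ℕ × obsPeriods t × Bool} (hx : (l, ⟨s, hs⟩, true) ≠ x) :
    Measurable[sigmaExcept M.sigmaAll (M.err t) x] (M.Y0 l s) := by
  have h1 := (M.measurable_μ0At_sigmaAll l s).mono (le_sigmaExcept M.sigmaAll (M.err t) x) le_rfl
  have h2 := measurable_sigmaExcept M.sigmaAll (M.err t) hx
  have : M.Y0 l s = fun ω => M.μ0At l s ω + M.err t (l, ⟨s, hs⟩, true) ω := by
    ext ω; simp [err, u]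
  rw [this]
  exact h1.add h2

lemma measurable_w_sigmaExcept {l : ℕ} {s : ℤ} (hs : s ∈ obsPeriods t)
    {x : ℕ × obsPeriods t × Bool} (hx : (l, ⟨s, hs⟩, false) ≠ x) :
    Measurable[sigmaExcept M.sigmaAll (M.err t) x] (M.w l s) := by
  have h1 := (M.measurable_pAt_sigmaAll l s).mono (le_sigmaExcept M.sigmaAll (M.err t) x) le_rfl
  have h2 := measurable_sigmaExcept M.sigmaAll (M.err t) hx
  have : M.w l s = fun ω => M.pAt l s ω + M.err t (l, ⟨s, hs⟩, false) ω := by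
    ext ω; simp [err, eps]
  rw [this]
  exact h1.add h2

end LatentPanel

namespace CrossFitting

variable (C : CrossFitting Ω J b) (M : LatentPanel Ω L d) (K : ℝ≥0 → ℝ) (t : ℤ) (g : ℕ → Fin J)
  (k : Fin b) (N : ℕ) (η : ℝ)

/-- Error of the estimated untreated mean of individual `i` for the partition `g` and the bandwidth `k`,
truncated at `η`. -/
noncomputable def muErr (i : ℕ) (ω : Ω) : ℝ :=
  clip η ((C.freeze g k).muHat M.untreated K t N i ω - M.μ0At i t ω)

/-- Error of the estimated treatment odds of individual `i` for the partition `g` and the bandwidth `k`,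
truncated at `η`. -/
noncomputable def oddsErr (i : ℕ) (ω : Ω) : ℝ :=
  clip η (odds ((C.freeze g k).pHat M.untreated K t N i ω) - odds (M.pAt i t ω))

/-- The part of the error of the sum of scores that is linear in the (truncated) errors of the
nuisance parameters. -/
noncomputable def linearTerm (ω : Ω) : ℝ :=
  ∑ i ∈ Finset.range N, (C.muErr M K t g k N η i ω / (1 - M.pAt i t ω) * M.eps i t ω +
    C.oddsErr M K t g k N η i ω * (1 - M.w i t ω) * M.u i t ω)

variable {K}

lemma measurable_muErr (hK : Measurable K) {i : ℕ} (hY : ∀ l, ∀ s ≤ 0, Measurable[𝓜] (M.Y0 l s))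
    (hw : ∀ j, g j ≠ g i → Measurable[𝓜] (M.w j t))
    (hYt : ∀ j, g j ≠ g i → Measurable[𝓜] (M.Y0 j t)) (hμ : Measurable[𝓜] (M.μ0At i t)) :
    Measurable[𝓜] (C.muErr M K t g k N η i) :=
  (measurable_clip η).comp
    ((C.measurable_muHat_freeze M.untreated t g k hK hY N i hw hYt).sub hμ)

lemma measurable_oddsErr (hK : Measurable K) {i : ℕ} (hY : ∀ l, ∀ s ≤ 0, Measurable[𝓜] (M.Y0 l s))
    (hw : ∀ j, g j ≠ g i → Measurable[𝓜] (M.w j t)) (hp : Measurable[𝓜] (M.pAt i t)) :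
    Measurable[𝓜] (C.oddsErr M K t g k N η i) :=
  (measurable_clip η).comp
    ((measurable_odds.comp (C.measurable_pHat_freeze M.untreated t g k hK hY N i hw)).sub
      (measurable_odds.comp hp))

lemma measurable_linearTerm (hK : Measurable K) (hY : ∀ l, ∀ s ∈ obsPeriods t, Measurable[𝓜] (M.Y0 l s))
    (hw : ∀ j, Measurable[𝓜] (M.w j t)) (hμ : ∀ j, Measurable[𝓜] (M.μ0At j t))
    (hp : ∀ j, Measurable[𝓜] (M.pAt j t)) :
    Measurable[𝓜] (C.linearTerm M K t g k N η) := by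
  have hY' : ∀ l, ∀ s ≤ 0, Measurable[𝓜] (M.Y0 l s) := fun l s hs => hY l s (Or.inl hs)
  have hYt : ∀ l, Measurable[𝓜] (M.Y0 l t) := fun l => hY l t (mem_obsPeriods_self t)
  refine Finset.measurable_fun_sum _ fun i _ => ?_
  refine Measurable.add (Measurable.mul (Measurable.div ?_ ?_) ?_)
    (Measurable.mul (Measurable.mul ?_ ?_) ?_)
  · exact C.measurable_muErr M t g k N η hK hY' (fun j _ => hw j) (fun j _ => hYt j) (hμ i)
  · exact measurable_const.sub (hp i)
  · exact (hw i).sub (hp i)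
  · exact C.measurable_oddsErr M t g k N η hK hY' (fun j _ => hw j) (hp i)
  · exact measurable_const.sub (hw i)
  · exact (hYt i).sub (hμ i)

lemma sq_sum_add_le {κ : Type*} [Fintype κ] (A B : κ → ℝ) :
    (∑ k, (A k + B k)) ^ 2 ≤ ∑ k, (2 * Fintype.card κ) * (A k ^ 2 + B k ^ 2) := by
  have h := sq_sum_le_card_mul_sum_sq (s := Finset.univ) (f := fun k => A k + B k)
  refine h.trans ?_
  rw [Finset.mul_sum, Finset.card_univ]
  refine Finset.sum_le_sum fun k _ => ?_
  have := sq_nonneg (A k - B k)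
  have h0 : (0 : ℝ) ≤ Fintype.card κ := Nat.cast_nonneg _
  nlinarith

variable {P : Measure Ω} [IsProbabilityMeasure P] [StandardBorelSpace Ω]
  {𝒜 : Set (EuclideanSpace ℝ (Fin d))}

/-- For a fixed partition and a fixed bandwidth the linear terms are of order `η √N`: within a fold
the nuisance estimates are functions of the latent factors, of the pre-treatment outcomes and of the
period-`t` data of the other folds, so the summands are uncorrelated. -/
lemma exists_lintegral_sq_linearTerm_le (ht : 0 < t) (h4 : M.ModelAssumption P t 𝒜 K) :
    ∃ D : ℝ, 0 ≤ D ∧ ∀ (g : ℕ → Fin J) (k : Fin b) (N : ℕ) (η : ℝ), 0 ≤ η →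
      ∫⁻ ω, ENNReal.ofReal (C.linearTerm M K t g k N η ω ^ 2) ∂P ≤
        ENNReal.ofReal (N * (η ^ 2 * D)) := by
  obtain ⟨c, hc, hov⟩ := h4.overlap
  obtain ⟨δ, hδ⟩ := h4.err_subgaussian
  obtain ⟨κ, hκ⟩ := h4.K_lipschitz
  have hK : Measurable K := hκ.continuous.measurable
  have hem := M.measurable_err t
  have hL2 : ∀ x, MemLp (M.err t x) 2 P := fun x => (hδ x).memLp_two (hem x)
  have hD := fun x => (hδ x).integral_sq_le (hem x)
  set D₀ := 4 * Real.exp (δ / 2) with hD₀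
  have hD0 : 0 ≤ D₀ := by positivity
  refine ⟨2 * J * (J * ((c⁻¹ ^ 2 + 1) * D₀)), by positivity, fun g k N η hη => ?_⟩
  let ix : Bool → ℕ → ℕ × obsPeriods t × Bool := fun β i => (i, ⟨t, mem_obsPeriods_self t⟩, β)
  have hix : ∀ β, Function.Injective (ix β) := fun β i j h => congrArg Prod.fst h
  let S : Fin J → Finset ℕ := fun f => (Finset.range N).filter fun i => g i = f
  let Z₁ : ℕ → Ω → ℝ := fun i ω => C.muErr M K t g k N η i ω / (1 - M.pAt i t ω)
  let Z₂ : ℕ → Ω → ℝ := fun i ω => C.oddsErr M K t g k N η i ω * (1 - M.w i t ω)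
  have hYpre : ∀ β j l, ∀ s ≤ 0, Measurable[sigmaExcept M.sigmaAll (M.err t) (ix β j)] (M.Y0 l s) :=
    fun β j l s hs => M.measurable_Y0_sigmaExcept t (Or.inl hs) fun h => by
      have : s = t := congrArg (fun z => (z.2.1 : ℤ)) h
      omega
  have hYt : ∀ β j l, l ≠ j → Measurable[sigmaExcept M.sigmaAll (M.err t) (ix β j)] (M.Y0 l t) :=
    fun β j l hl => M.measurable_Y0_sigmaExcept t (mem_obsPeriods_self t) fun h =>
      hl (congrArg Prod.fst h)
  have hw : ∀ β j l, l ≠ j → Measurable[sigmaExcept M.sigmaAll (M.err t) (ix β j)] (M.w l t) :=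
    fun β j l hl => M.measurable_w_sigmaExcept t (mem_obsPeriods_self t) fun h =>
      hl (congrArg Prod.fst h)
  -- Treatment indicators never involve an outcome error, not even that of the same individual.
  have hw' : ∀ j l, Measurable[sigmaExcept M.sigmaAll (M.err t) (ix true j)] (M.w l t) :=
    fun j l => M.measurable_w_sigmaExcept t (mem_obsPeriods_self t) fun h => by
      have := congrArg (fun z => z.2.2) h
      simp [ix] at this
  have hμ : ∀ β j l, Measurable[sigmaExcept M.sigmaAll (M.err t) (ix β j)] (M.μ0At l t) :=
    fun β j l => (M.measurable_μ0At_sigmaAll l t).mono (le_sigmaExcept _ _ _) le_rfl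
  have hp : ∀ β j l, Measurable[sigmaExcept M.sigmaAll (M.err t) (ix β j)] (M.pAt l t) :=
    fun β j l => (M.measurable_pAt_sigmaAll l t).mono (le_sigmaExcept _ _ _) le_rfl
  -- An individual used in the nuisance estimates of `i` lies outside the fold of `i` and `j`.
  have hne : ∀ f, ∀ i ∈ S f, ∀ j ∈ S f, ∀ l, g l ≠ g i → l ≠ j := fun f i hi j hj l hl h => by
    rw [h, (Finset.mem_filter.1 hi).2, (Finset.mem_filter.1 hj).2] at hl
    exact hl rfl
  have hZ₁ : ∀ f, ∀ i ∈ S f, ∀ j ∈ S f,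
      Measurable[sigmaExcept M.sigmaAll (M.err t) (ix false j)] (Z₁ i) := fun f i hi j hj =>
    (C.measurable_muErr M t g k N η hK (hYpre _ j) (fun l hl => hw _ j l (hne f i hi j hj l hl))
      (fun l hl => hYt _ j l (hne f i hi j hj l hl)) (hμ _ j i)).div
      (measurable_const.sub (hp _ j i))
  have hZ₂ : ∀ f, ∀ i ∈ S f, ∀ j ∈ S f,
      Measurable[sigmaExcept M.sigmaAll (M.err t) (ix true j)] (Z₂ i) := fun f i hi j hj =>
    (C.measurable_oddsErr M t g k N η hK (hYpre _ j) (fun l _ => hw' j l) (hp _ j i)).mul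
      (measurable_const.sub (hw' j i))
  have hB₁ : ∀ f, ∀ i ∈ S f, ∀ᵐ ω ∂P, |Z₁ i ω| ≤ η * c⁻¹ := fun f i _ => by
    filter_upwards [hov i] with ω hω
    have h1 : c ≤ 1 - M.pAt i t ω := by linarith [hω.2]
    simp only [Z₁]
    rw [abs_div, div_eq_mul_inv, abs_of_pos (hc.trans_le h1)]
    exact mul_le_mul (abs_clip_le hη _) (inv_anti₀ hc h1)
      (inv_nonneg.2 (hc.le.trans h1)) hη
  have hB₂ : ∀ f, ∀ i ∈ S f, ∀ᵐ ω ∂P, |Z₂ i ω| ≤ η := fun f i _ => ae_of_all _ fun ω => by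
    simp only [Z₂]
    rw [abs_mul]
    refine (mul_le_of_le_one_right (abs_nonneg _) ?_).trans (abs_clip_le hη _)
    rcases M.w_binary i t ω with h | h <;> simp [h]
  have hA := fun f => lintegral_sq_sum_le_of_iCondIndepFun M.sigmaAll_le hem h4.err_indep hL2
    h4.err_mean hD (S f) (hix false) (hB₁ f) (hZ₁ f)
  have hB := fun f => lintegral_sq_sum_le_of_iCondIndepFun M.sigmaAll_le hem h4.err_indep hL2
    h4.err_mean hD (S f) (hix true) (hB₂ f) (hZ₂ f)
  have hZ₁m : ∀ i, Measurable (Z₁ i) := fun i =>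
    (C.measurable_muErr M t g k N η hK (fun l s _ => M.measurable_Y0 l s)
      (fun l _ => M.measurable_w l t) (fun l _ => M.measurable_Y0 l t) (M.measurable_μ0At i t)).div
      (measurable_const.sub (M.measurable_pAt i t))
  have hZ₂m : ∀ i, Measurable (Z₂ i) := fun i =>
    (C.measurable_oddsErr M t g k N η hK (fun l s _ => M.measurable_Y0 l s)
      (fun l _ => M.measurable_w l t) (M.measurable_pAt i t)).mul
      (measurable_const.sub (M.measurable_w i t))
  have hsum : ∀ ω, C.linearTerm M K t g k N η ω =
      ∑ f : Fin J, ((∑ i ∈ S f, Z₁ i ω * M.err t (ix false i) ω) +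
        ∑ i ∈ S f, Z₂ i ω * M.err t (ix true i) ω) := fun ω => by
    simp only [← Finset.sum_add_distrib]
    exact (Finset.sum_fiberwise (Finset.range N) g _).symm
  have hcard : ∀ f, ((S f).card : ℝ) ≤ N := fun f => by
    exact_mod_cast (Finset.card_filter_le _ _).trans_eq (Finset.card_range N)
  have hAm : ∀ f, Measurable fun ω => ∑ i ∈ S f, Z₁ i ω * M.err t (ix false i) ω := fun f =>
    Finset.measurable_fun_sum _ fun i _ => (hZ₁m i).mul (hem _)
  have hBm : ∀ f, Measurable fun ω => ∑ i ∈ S f, Z₂ i ω * M.err t (ix true i) ω := fun f =>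
    Finset.measurable_fun_sum _ fun i _ => (hZ₂m i).mul (hem _)
  calc ∫⁻ ω, ENNReal.ofReal (C.linearTerm M K t g k N η ω ^ 2) ∂P
      ≤ ∫⁻ ω, ∑ f : Fin J, ENNReal.ofReal (2 * J) *
          (ENNReal.ofReal ((∑ i ∈ S f, Z₁ i ω * M.err t (ix false i) ω) ^ 2) +
            ENNReal.ofReal ((∑ i ∈ S f, Z₂ i ω * M.err t (ix true i) ω) ^ 2)) ∂P := by
        refine lintegral_mono fun ω => ?_
        rw [hsum]
        refine (ENNReal.ofReal_le_ofReal (sq_sum_add_le _ _)).trans ?_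
        rw [ENNReal.ofReal_sum_of_nonneg fun f _ => by positivity]
        refine Finset.sum_le_sum fun f _ => ?_
        rw [ENNReal.ofReal_mul (by positivity), ENNReal.ofReal_add (sq_nonneg _) (sq_nonneg _),
          Fintype.card_fin]
    _ = ∑ f : Fin J, ENNReal.ofReal (2 * J) *
          (∫⁻ ω, ENNReal.ofReal ((∑ i ∈ S f, Z₁ i ω * M.err t (ix false i) ω) ^ 2) ∂P +
            ∫⁻ ω, ENNReal.ofReal ((∑ i ∈ S f, Z₂ i ω * M.err t (ix true i) ω) ^ 2) ∂P) := by
        rw [lintegral_finsetSum _ fun f _ => by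
          have := hAm f; have := hBm f; fun_prop]
        refine Finset.sum_congr rfl fun f _ => ?_
        have h1 := hAm f
        have h2 := hBm f
        rw [lintegral_const_mul _ (by fun_prop), lintegral_add_left (by fun_prop)]
    _ ≤ ∑ f : Fin J, ENNReal.ofReal (2 * J) * ENNReal.ofReal (N * (η ^ 2 * ((c⁻¹ ^ 2 + 1) * D₀))) := by
        gcongr with f
        refine (add_le_add (hA f) (hB f)).trans ?_
        rw [← ENNReal.ofReal_add (by positivity) (by positivity)]
        refine ENNReal.ofReal_le_ofReal ?_
        calc ((S f).card : ℝ) * ((η * c⁻¹) ^ 2 * D₀) + (S f).card * (η ^ 2 * D₀)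
            = (S f).card * (η ^ 2 * ((c⁻¹ ^ 2 + 1) * D₀)) := by ring
          _ ≤ _ := mul_le_mul_of_nonneg_right (hcard f) (by positivity)
    _ = ENNReal.ofReal (N * (η ^ 2 * (2 * J * (J * ((c⁻¹ ^ 2 + 1) * D₀))))) := by
        rw [Finset.sum_const, Finset.card_univ, Fintype.card_fin, nsmul_eq_mul,
          ← ENNReal.ofReal_mul (by positivity), ← ENNReal.ofReal_natCast,
          ← ENNReal.ofReal_mul (by positivity)]
        congr 1
        ring

end CrossFitting

end LinearTerms

/-! ### Random partitions and data-dependent bandwidths -/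

section CrossFit

variable {Ω : Type*} {𝓜 : MeasurableSpace Ω} [mΩ : MeasurableSpace Ω] {L : Type*}
  [MeasurableSpace L] {d J b : ℕ}

/-- Second moments survive a random choice between finitely many variables: an index `φ` that is
independent of the variables costs nothing, an arbitrary index `sel` the number of its values. -/
lemma lintegral_random_index_le {ι κ : Type*} [Fintype ι] [Fintype κ] [MeasurableSpace ι]
    [MeasurableSingletonClass ι] {P : Measure Ω} [IsProbabilityMeasure P] {φ : Ω → ι} {sel : Ω → κ}
    (hφ : Measurable φ) (h𝓜 : 𝓜 ≤ mΩ)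
    (hind : Indep (MeasurableSpace.comap φ inferInstance) 𝓜 P)
    {F : ι → κ → Ω → ℝ≥0∞} (hF : ∀ g k, Measurable[𝓜] (F g k)) {B : ℝ≥0∞}
    (hB : ∀ g k, ∫⁻ ω, F g k ω ∂P ≤ B) :
    ∫⁻ ω, F (φ ω) (sel ω) ω ∂P ≤ Fintype.card κ * B := by
  classical
  have hFm : ∀ g k, Measurable (F g k) := fun g k => (hF g k).mono h𝓜 le_rfl
  have hI : ∀ g, Measurable[MeasurableSpace.comap φ inferInstance]
      fun ω => ({g} : Set ι).indicator (1 : ι → ℝ≥0∞) (φ ω) := fun g =>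
    (measurable_one.indicator (measurableSet_singleton g)).comp (comap_measurable φ)
  have hIm : ∀ g, Measurable fun ω => ({g} : Set ι).indicator (1 : ι → ℝ≥0∞) (φ ω) := fun g =>
    (hI g).mono hφ.comap_le le_rfl
  calc ∫⁻ ω, F (φ ω) (sel ω) ω ∂P
      ≤ ∫⁻ ω, ∑ k, ∑ g, ({g} : Set ι).indicator (1 : ι → ℝ≥0∞) (φ ω) * F g k ω ∂P := by
        refine lintegral_mono fun ω => ?_
        refine le_trans ?_ (Finset.single_le_sum
          (f := fun k => ∑ g, ({g} : Set ι).indicator (1 : ι → ℝ≥0∞) (φ ω) * F g k ω)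
          (fun _ _ => zero_le) (Finset.mem_univ (sel ω)))
        refine le_trans ?_ (Finset.single_le_sum
          (f := fun g => ({g} : Set ι).indicator (1 : ι → ℝ≥0∞) (φ ω) * F g (sel ω) ω)
          (fun _ _ => zero_le) (Finset.mem_univ (φ ω)))
        simp
    _ = ∑ k, ∑ g, (∫⁻ ω, ({g} : Set ι).indicator (1 : ι → ℝ≥0∞) (φ ω) ∂P) *
          ∫⁻ ω, F g k ω ∂P := by
        have hmul : ∀ g k, Measurable fun ω =>
            ({g} : Set ι).indicator (1 : ι → ℝ≥0∞) (φ ω) * F g k ω :=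
          fun g k => (hIm g).mul (hFm g k)
        rw [lintegral_finsetSum _ fun k _ => Finset.measurable_fun_sum _ fun g _ => hmul g k]
        refine Finset.sum_congr rfl fun k _ => ?_
        rw [lintegral_finsetSum _ fun g _ => hmul g k]
        exact Finset.sum_congr rfl fun g _ =>
          lintegral_mul_eq_lintegral_mul_lintegral_of_independent_measurableSpace hφ.comap_le h𝓜
            hind (hI g) (hF g k)
    _ ≤ ∑ _k : κ, ∑ g, (∫⁻ ω, ({g} : Set ι).indicator (1 : ι → ℝ≥0∞) (φ ω) ∂P) * B := by
        gcongr with k _ g _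
        exact hB g k
    _ = Fintype.card κ * B := by
        rw [Finset.sum_const, ← Finset.sum_mul, ← lintegral_finsetSum _ fun g _ => hIm g]
        simp

namespace CrossFitting

variable (C : CrossFitting Ω J b) (M : LatentPanel Ω L d) (K : ℝ≥0 → ℝ) (t : ℤ)

/-- The partition of the sample of size `N`. -/
def partition (N : ℕ) (ω : Ω) (i : Fin N) : Fin J := C.fold N ω i

lemma measurable_partition (N : ℕ) : Measurable (C.partition N) :=
  measurable_pi_lambda _ fun i => (measurable_pi_apply (i : ℕ)).comp (C.measurable_fold N)

/-- A variable that depends on the partition and the selected bandwidth is measurable if it is so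
for each of their finitely many values. -/
lemma measurable_of_forall_partition {N : ℕ} {F : (Fin N → Fin J) → Fin b → Ω → ℝ}
    (hF : ∀ g k, Measurable (F g k)) :
    Measurable fun ω => F (C.partition N ω) (C.sel N ω) ω := by
  have h := measurable_from_prod_countable_right
    (f := fun z : ((Fin N → Fin J) × Fin b) × Ω => F z.1.1 z.1.2 z.2) fun z => hF z.1 z.2
  exact h.comp (((C.measurable_partition N).prodMk (C.measurable_sel N)).prodMk measurable_id)

/-- Extension of a partition of `{0, …, N - 1}` to `ℕ`, constant equal to `f₀` from `N` on. Only the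
folds of the sample matter, and there are finitely many of these partitions. -/
def extendPartition {N : ℕ} (f₀ : Fin J) (g : Fin N → Fin J) (i : ℕ) : Fin J :=
  if h : i < N then g ⟨i, h⟩ else f₀

lemma extendPartition_partition (f₀ : Fin J) (N : ℕ) (ω : Ω) :
    ∀ j < N, extendPartition f₀ (C.partition N ω) j = C.fold N ω j := fun j hj => by
  simp [extendPartition, partition, hj]

/-- The linear part of the error of the sum of scores, for the partition and the bandwidth in
use. -/
noncomputable def linearPart (f₀ : Fin J) (N : ℕ) (η : ℝ) (ω : Ω) : ℝ :=
  C.linearTerm M K t (extendPartition f₀ (C.partition N ω)) (C.sel N ω) N η ω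

variable {K} {P : Measure Ω} [IsProbabilityMeasure P] [StandardBorelSpace Ω]
  {𝒜 : Set (EuclideanSpace ℝ (Fin d))}

/-- The bound for a fixed partition and bandwidth persists for the partition and the bandwidth in
use, because the former is independent of the panel and the latter has `b` values. -/
lemma exists_lintegral_sq_linearPart_le (ht : 0 < t) (h4 : M.ModelAssumption P t 𝒜 K)
    (hfold : C.FoldsIndependent M P) (f₀ : Fin J) :
    ∃ D : ℝ, 0 ≤ D ∧ ∀ (N : ℕ) (η : ℝ), 0 ≤ η →
      ∫⁻ ω, ENNReal.ofReal (C.linearPart M K t f₀ N η ω ^ 2) ∂P ≤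
        ENNReal.ofReal (N * (η ^ 2 * D)) := by
  obtain ⟨D, hD, hle⟩ := C.exists_lintegral_sq_linearTerm_le M t ht h4
  obtain ⟨κ, hκ⟩ := h4.K_lipschitz
  have hK : Measurable K := hκ.continuous.measurable
  refine ⟨b * D, by positivity, fun N η hη => ?_⟩
  set panel := fun ω => ((fun i => M.α i ω, fun s => M.lam s ω),
      fun (i : ℕ) (s : ℤ) => (M.Y0 i s ω, M.Y i s ω, M.w i s ω)) with hpanel
  have hpm : Measurable panel := by
    refine ((measurable_pi_lambda _ M.measurable_α).prodMk
      (measurable_pi_lambda _ M.measurable_lam)).prodMk ?_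
    exact measurable_pi_lambda _ fun i => measurable_pi_lambda _ fun s =>
      (M.measurable_Y0 i s).prodMk ((M.measurable_Y i s).prodMk (M.measurable_w i s))
  have hc : Measurable[MeasurableSpace.comap panel inferInstance] panel :=
    Measurable.of_comap_le le_rfl
  have hα : M.sigmaAll ≤ MeasurableSpace.comap panel inferInstance :=
    (measurable_fst.comp hc).comap_le
  have hdata : ∀ i s, Measurable[MeasurableSpace.comap panel inferInstance]
      fun ω => (M.Y0 i s ω, M.Y i s ω, M.w i s ω) := fun i s =>
    (measurable_pi_apply s).comp ((measurable_pi_apply i).comp (measurable_snd.comp hc))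
  have hm : ∀ (g : ℕ → Fin J) k, Measurable[MeasurableSpace.comap panel inferInstance]
      (C.linearTerm M K t g k N η) := fun g k =>
    C.measurable_linearTerm M t g k N η hK (fun l s _ => measurable_fst.comp (hdata l s))
      (fun l => measurable_snd.comp (measurable_snd.comp (hdata l t)))
      (fun l => (M.measurable_μ0At_sigmaAll l t).mono hα le_rfl)
      (fun l => (M.measurable_pAt_sigmaAll l t).mono hα le_rfl)
  have hind : IndepFun (C.partition N) panel P :=
    (hfold N).comp (φ := fun (g : ℕ → Fin J) (i : Fin N) => g i) (ψ := id)
      (measurable_pi_lambda _ fun i => measurable_pi_apply (i : ℕ)) measurable_id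
  have := lintegral_random_index_le (C.measurable_partition N) hpm.comap_le hind
    (F := fun g k ω => ENNReal.ofReal (C.linearTerm M K t (extendPartition f₀ g) k N η ω ^ 2))
    (fun g k => ((hm _ k).pow_const 2).ennreal_ofReal) (fun g k => hle _ k N η hη)
    (sel := C.sel N)
  refine this.trans_eq ?_
  rw [Fintype.card_fin, ← ENNReal.ofReal_natCast, ← ENNReal.ofReal_mul (by positivity)]
  congr 1
  ring

omit [StandardBorelSpace Ω] in
lemma measurable_attHat (hK : Measurable K) (N : ℕ) : Measurable (C.attHat M K t N) := by
  rcases isEmpty_or_nonempty Ω with hΩ | ⟨⟨ω₀⟩⟩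
  · exact measurable_of_empty _
  let f₀ := C.fold 0 ω₀ 0
  have h' := C.measurable_of_forall_partition (N := N)
    (F := fun g k => (C.freeze (extendPartition f₀ g) k).attHat M K t N) fun g k => by
    refine Measurable.div (Finset.measurable_fun_sum _ fun i _ => ?_)
      (Finset.measurable_fun_sum _ fun i _ => M.measurable_w i t)
    have h1 := C.measurable_pHat_freeze M t (extendPartition f₀ g) k hK
      (fun l s _ => M.measurable_Y l s) N i (fun j _ => M.measurable_w j t)
    have h2 := C.measurable_muHat_freeze M t (extendPartition f₀ g) k hK
      (fun l s _ => M.measurable_Y l s) N i (fun j _ => M.measurable_w j t)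
      (fun j _ => M.measurable_Y j t)
    have h3 := M.measurable_Y i t
    have h4 := M.measurable_w i t
    unfold drScore
    fun_prop
  convert h' using 1
  ext ω
  simp only [attHat]
  congr 1
  refine Finset.sum_congr rfl fun i hi => ?_
  rw [C.muHat_freeze M K t (C.extendPartition_partition f₀ N ω) (Finset.mem_range.1 hi),
    C.pHat_freeze M K t (C.extendPartition_partition f₀ N ω) (Finset.mem_range.1 hi)]

/-- Sum of the errors of the scores. -/
noncomputable def scoreError (C : CrossFitting Ω J b) (M : LatentPanel Ω L d) (K : ℝ≥0 → ℝ) (t : ℤ)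
    (N : ℕ) (ω : Ω) : ℝ :=
  ∑ i ∈ Finset.range N,
    (drScore (M.Y i t ω) (M.w i t ω) (C.pHat M K t N i ω) (C.muHat M K t N i ω) -
      M.oracleScore t i ω)

omit [StandardBorelSpace Ω] in
/-- When the nuisance estimates are close to the truth, the error of the sum of scores is its
linear part up to the product of the nuisance errors. -/
lemma abs_scoreError_add_linearPart_le (f₀ : Fin J) {N : ℕ} {ω : Ω} {c η : ℝ} (hc : 0 < c)
    (hna : ∀ l, ∀ s ∈ obsPeriods t, M.w l s ω = 0 → M.Y l s ω = M.Y0 l s ω)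
    (hov : ∀ i, M.pAt i t ω ≤ 1 - c)
    (hp : ⨆ i : Fin N, |C.pHat M K t N i ω - M.pAt i t ω| ≤ min (c / 2) (η * (c ^ 2 / 2)))
    (hμ : ⨆ i : Fin N, |C.muHat M K t N i ω - M.μ0At i t ω| ≤ η) :
    |C.scoreError M K t N ω + C.linearPart M K t f₀ N η ω| ≤ N * (2 / c ^ 2 * ⨆ i : Fin N,
      |(M.pAt i t ω - C.pHat M K t N i ω) * (M.μ0At i t ω - C.muHat M K t N i ω)|) := by
  set B := ⨆ i : Fin N,
      |(M.pAt i t ω - C.pHat M K t N i ω) * (M.μ0At i t ω - C.muHat M K t N i ω)| with hB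
  have hsup : ∀ (F : Fin N → ℝ) (i : Fin N), F i ≤ ⨆ j, F j := fun F i =>
    le_ciSup (Set.finite_range F).bddAbove i
  unfold scoreError linearPart linearTerm
  rw [← Finset.sum_add_distrib]
  refine (Finset.abs_sum_le_sum_abs _ _).trans ?_
  have : ((N : ℝ) * (2 / c ^ 2 * B)) = ∑ i ∈ Finset.range N, 2 / c ^ 2 * B := by simp
  rw [this]
  refine Finset.sum_le_sum fun i hi => ?_
  have hi := Finset.mem_range.1 hi
  set q := C.pHat M K t N i ω with hq
  set n := C.muHat M K t N i ω with hn
  set p := M.pAt i t ω with hpdef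
  set m := M.μ0At i t ω with hmdef
  have hqp := (hsup (fun i : Fin N => |C.pHat M K t N i ω - M.pAt i t ω|) ⟨i, hi⟩).trans hp
  have hnm := (hsup (fun i : Fin N => |C.muHat M K t N i ω - M.μ0At i t ω|) ⟨i, hi⟩).trans hμ
  have hprod := hsup (fun i : Fin N =>
    |(M.pAt i t ω - C.pHat M K t N i ω) * (M.μ0At i t ω - C.muHat M K t N i ω)|) ⟨i, hi⟩
  simp only [← hq, ← hn, ← hpdef, ← hmdef, ← hB] at hqp hnm hprod
  have hqp1 := hqp.trans (min_le_left _ _)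
  have hqp2 := hqp.trans (min_le_right _ _)
  have hodds := abs_odds_sub_le hc (hov i) hqp1
  have hodds' : |odds q - odds p| ≤ η := by
    refine hodds.trans ((mul_le_mul_of_nonneg_left hqp2 (by positivity)).trans_eq ?_)
    field_simp
  have hna' : ∀ l, ∀ s ≤ 0, M.Y l s ω = M.Y0 l s ω := fun l s hs =>
    hna l s (Or.inl hs) (M.w_pre l s ω hs)
  have hext := C.extendPartition_partition f₀ N ω
  have e1 : C.muErr M K t (extendPartition f₀ (C.partition N ω)) (C.sel N ω) N η i ω = n - m := by
    unfold muErr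
    rw [CrossFitting.muHat_untreated _ M K t hna, C.muHat_freeze M K t hext hi]
    exact clip_of_abs_le hnm
  have e2 : C.oddsErr M K t (extendPartition f₀ (C.partition N ω)) (C.sel N ω) N η i ω =
      odds q - odds p := by
    unfold oddsErr
    rw [CrossFitting.pHat_untreated _ M K t hna', C.pHat_freeze M K t hext hi]
    exact clip_of_abs_le hodds'
  have e3 : (1 - M.w i t ω) * (M.Y i t ω - m) = (1 - M.w i t ω) * M.u i t ω := by
    rcases M.w_binary i t ω with h | h
    · rw [hna i t (mem_obsPeriods_self t) h]; rfl
    · simp [h]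
  have hw : |1 - M.w i t ω| ≤ 1 := by
    rcases M.w_binary i t ω with h | h <;> simp [h]
  have h1p : 1 - p ≠ 0 := by have := hov i; intro h; linarith
  have h1q : 1 - q ≠ 0 := by
    have := hov i; have := (abs_le.1 hqp1).2; intro h; linarith
  have e : drScore (M.Y i t ω) (M.w i t ω) q n - M.oracleScore t i ω +
      ((n - m) / (1 - p) * M.eps i t ω + (odds q - odds p) * (1 - M.w i t ω) * M.u i t ω) =
      (1 - M.w i t ω) * ((n - m) * (odds q - odds p)) := by
    have h := drScore_sub_drScore (y := M.Y i t ω) (m := m) (n := n) (M.w_binary i t ω) h1p h1q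
    have h' : M.oracleScore t i ω = drScore (M.Y i t ω) (M.w i t ω) p m := rfl
    have h'' : M.eps i t ω = M.w i t ω - p := rfl
    rw [h', h, h'']
    linear_combination (-(odds q - odds p)) * e3
  rw [e1, e2, e, abs_mul, abs_mul]
  calc |1 - M.w i t ω| * (|n - m| * |odds q - odds p|)
      ≤ 1 * (|n - m| * (2 / c ^ 2 * |q - p|)) := by gcongr
    _ = 2 / c ^ 2 * |(p - q) * (m - n)| := by
        rw [abs_mul, abs_sub_comm p q, abs_sub_comm m n]; ring
    _ ≤ 2 / c ^ 2 * B := by gcongr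

end CrossFitting

end CrossFit

/-! ### Negligibility of the estimation error -/

section Remainder

variable {Ω : Type*} [mΩ : MeasurableSpace Ω] {L : Type*}
  [MeasurableSpace L] {d J b : ℕ}

/-- Convergence to zero in probability survives a factor that converges almost surely and an error
that vanishes almost surely. -/
lemma tendstoInMeasure_mul_add_of_tendsto_ae {P : Measure Ω} [IsFiniteMeasure P]
    {X Y e : ℕ → Ω → ℝ} {y : Ω → ℝ} (hX : TendstoInMeasure P X atTop fun _ => 0)
    (hY : ∀ᵐ ω ∂P, Tendsto (fun n => Y n ω) atTop (𝓝 (y ω)))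
    (he : ∀ᵐ ω ∂P, Tendsto (fun n => e n ω) atTop (𝓝 0))
    (hm : ∀ n, AEStronglyMeasurable (fun ω => X n ω * Y n ω + e n ω) P) :
    TendstoInMeasure P (fun n ω => X n ω * Y n ω + e n ω) atTop fun _ => 0 := by
  rw [exists_seq_tendstoInMeasure_atTop_iff hm]
  intro ns hns
  obtain ⟨ns', hns', hae⟩ := (hX.comp hns.tendsto_atTop).exists_seq_tendsto_ae
  refine ⟨ns', hns', ?_⟩
  have ht := (hns.comp hns').tendsto_atTop
  filter_upwards [hae, hY, he] with ω h1 h2 h3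
  simpa using (h1.mul (h2.comp ht)).add (h3.comp ht)

namespace CrossFitting

variable (C : CrossFitting Ω J b) (M : LatentPanel Ω L d) {K : ℝ≥0 → ℝ} (t : ℤ)
  {P : Measure Ω} [IsProbabilityMeasure P]
  {𝒜 : Set (EuclideanSpace ℝ (Fin d))}

lemma measurable_linearPart (hK : Measurable K) (f₀ : Fin J) (N : ℕ) (η : ℝ) :
    Measurable (C.linearPart M K t f₀ N η) := by
  exact C.measurable_of_forall_partition
    (F := fun g k => C.linearTerm M K t (extendPartition f₀ g) k N η) fun g k =>
    C.measurable_linearTerm M t (extendPartition f₀ g) k N η hK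
      (fun l s _ => M.measurable_Y0 l s) (fun l => M.measurable_w l t)
      (fun l => M.measurable_μ0At l t) (fun l => M.measurable_pAt l t)

variable [StandardBorelSpace Ω]

/-- The errors of the scores cancel in the sum, up to `o_p(√N)`: the product of the nuisance errors is
small by hypothesis, and the linear part by Markov's inequality, once the level `η` of the truncation
is small. -/
lemma tendstoInMeasure_scoreError (ht : 0 < t) (h1 : M.NoAnticipation P t)
    (h4 : M.ModelAssumption P t 𝒜 K) (hfold : C.FoldsIndependent M P)
    (hp : IsLittleOpOne P fun N ω => ⨆ i : Fin N, |C.pHat M K t N i ω - M.pAt i t ω|)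
    (hμ : IsLittleOpOne P fun N ω => ⨆ i : Fin N, |C.muHat M K t N i ω - M.μ0At i t ω|)
    (hprod : IsLittleOpOne P fun N ω => √(N : ℝ) * ⨆ i : Fin N,
      |(M.pAt i t ω - C.pHat M K t N i ω) * (M.μ0At i t ω - C.muHat M K t N i ω)|) :
    TendstoInMeasure P (fun (N : ℕ) ω => (√(N : ℝ))⁻¹ * C.scoreError M K t N ω) atTop
      fun _ => 0 := by
  obtain ⟨ω₀⟩ : Nonempty Ω := nonempty_of_isProbabilityMeasure P
  let f₀ := C.fold 0 ω₀ 0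
  obtain ⟨c, hc, hov⟩ := h4.overlap
  obtain ⟨κ, hκ⟩ := h4.K_lipschitz
  have hK : Measurable K := hκ.continuous.measurable
  obtain ⟨D, hD, hlin⟩ := C.exists_lintegral_sq_linearPart_le M t ht h4 hfold f₀
  unfold IsLittleOpOne at hp hμ hprod
  rw [tendstoInMeasure_iff_norm] at hp hμ hprod ⊢
  simp only [sub_zero] at hp hμ hprod ⊢
  intro ε hε
  rw [ENNReal.tendsto_nhds_zero]
  intro θ hθ
  have hθ4 : 0 < θ / 4 := ENNReal.div_pos hθ.ne' (by simp)
  obtain ⟨η, hηθ, hη⟩ : ∃ η : ℝ, ENNReal.ofReal (η ^ 2 * D / (ε / 2) ^ 2) ≤ θ / 4 ∧ 0 < η := by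
    have hcont : Tendsto (fun η : ℝ => ENNReal.ofReal (η ^ 2 * D / (ε / 2) ^ 2)) (𝓝[>] 0) (𝓝 0) := by
      have : Continuous fun η : ℝ => ENNReal.ofReal (η ^ 2 * D / (ε / 2) ^ 2) :=
        ENNReal.continuous_ofReal.comp (by fun_prop)
      have h := (this.tendsto 0).mono_left (nhdsWithin_le_nhds (s := Set.Ioi 0))
      simpa using h
    exact ((ENNReal.tendsto_nhds_zero.1 hcont _ hθ4).and self_mem_nhdsWithin).exists
  have hη₁ : 0 < min (c / 2) (η * (c ^ 2 / 2)) := by positivity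
  have hε₃ : 0 < ε * c ^ 2 / 4 := by positivity
  filter_upwards [ENNReal.tendsto_nhds_zero.1 (hp _ hη₁) _ hθ4,
    ENNReal.tendsto_nhds_zero.1 (hμ _ hη) _ hθ4,
    ENNReal.tendsto_nhds_zero.1 (hprod _ hε₃) _ hθ4, eventually_gt_atTop 0] with N hN1 hN2 hN3 hN
  have hN' : (0 : ℝ) < N := Nat.cast_pos.2 hN
  have hN4 : P {ω | ENNReal.ofReal (N * (ε / 2) ^ 2) ≤
      ENNReal.ofReal (C.linearPart M K t f₀ N η ω ^ 2)} ≤ θ / 4 := by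
    refine (meas_ge_le_lintegral_div
      ((C.measurable_linearPart M t hK f₀ N η).pow_const 2).ennreal_ofReal.aemeasurable
      (ENNReal.ofReal_pos.2 (by positivity)).ne' ENNReal.ofReal_ne_top).trans ?_
    refine le_trans ?_ hηθ
    refine (ENNReal.div_le_div_right (hlin N η hη.le) _).trans_eq ?_
    rw [← ENNReal.ofReal_div_of_pos (by positivity)]
    congr 1
    field_simp
  have hsub : ∀ᵐ ω ∂P, ε ≤ ‖(√(N : ℝ))⁻¹ * C.scoreError M K t N ω‖ →
      ((min (c / 2) (η * (c ^ 2 / 2)) ≤ ‖⨆ i : Fin N, |C.pHat M K t N i ω - M.pAt i t ω|‖ ∨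
      η ≤ ‖⨆ i : Fin N, |C.muHat M K t N i ω - M.μ0At i t ω|‖) ∨
      ε * c ^ 2 / 4 ≤ ‖√(N : ℝ) * ⨆ i : Fin N,
        |(M.pAt i t ω - C.pHat M K t N i ω) * (M.μ0At i t ω - C.muHat M K t N i ω)|‖) ∨
      ENNReal.ofReal (N * (ε / 2) ^ 2) ≤ ENNReal.ofReal (C.linearPart M K t f₀ N η ω ^ 2) := by
    have hna : ∀ᵐ ω ∂P, ∀ l, ∀ s : obsPeriods t, M.w l s ω = 0 → M.Y l s ω = M.Y0 l s ω :=
      ae_all_iff.2 fun l => ae_all_iff.2 fun s => h1 l s s.2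
    filter_upwards [hna, ae_all_iff.2 hov] with ω hna hov
    contrapose!
    rintro ⟨⟨⟨b1, b2⟩, b3⟩, b4⟩
    have hle := C.abs_scoreError_add_linearPart_le M t f₀ hc (fun l s hs => hna l ⟨s, hs⟩)
      (fun i => (hov i).2) ((le_abs_self _).trans b1.le) ((le_abs_self _).trans b2.le)
    set B := ⨆ i : Fin N,
      |(M.pAt i t ω - C.pHat M K t N i ω) * (M.μ0At i t ω - C.muHat M K t N i ω)|
    have hB : √(N : ℝ) * B < ε * c ^ 2 / 4 := (le_abs_self _).trans_lt b3
    have hsq : √(N : ℝ) * √N = N := Real.mul_self_sqrt hN'.le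
    have hs : 0 < √(N : ℝ) := Real.sqrt_pos.2 hN'
    have hl : |C.linearPart M K t f₀ N η ω| < √N * (ε / 2) := by
      refine abs_lt_of_sq_lt_sq ?_ (by positivity)
      rw [mul_pow, Real.sq_sqrt hN'.le]
      exact (ENNReal.ofReal_lt_ofReal_iff_of_nonneg (sq_nonneg _)).1 b4
    have hr : N * (2 / c ^ 2 * B) < √N * (ε / 2) := by
      calc N * (2 / c ^ 2 * B) = √N * (2 / c ^ 2 * (√N * B)) := by
            rw [← hsq, Real.sqrt_mul_self hs.le]; ring
        _ < √N * (2 / c ^ 2 * (ε * c ^ 2 / 4)) := by gcongr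
        _ = √N * (ε / 2) := by field_simp; norm_num
    have habs : |C.scoreError M K t N ω| < √N * ε := by
      have := abs_sub (C.scoreError M K t N ω + C.linearPart M K t f₀ N η ω)
        (C.linearPart M K t f₀ N η ω)
      rw [add_sub_cancel_right] at this
      linarith
    rw [Real.norm_eq_abs, abs_mul, abs_of_pos (inv_pos.2 hs)]
    calc (√(N : ℝ))⁻¹ * |C.scoreError M K t N ω| < (√(N : ℝ))⁻¹ * (√N * ε) := by gcongr
      _ = ε := by field_simp
  calc P {ω | ε ≤ ‖(√(N : ℝ))⁻¹ * C.scoreError M K t N ω‖}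
      ≤ P ((({ω | min (c / 2) (η * (c ^ 2 / 2)) ≤
            ‖⨆ i : Fin N, |C.pHat M K t N i ω - M.pAt i t ω|‖} ∪
          {ω | η ≤ ‖⨆ i : Fin N, |C.muHat M K t N i ω - M.μ0At i t ω|‖}) ∪
          {ω | ε * c ^ 2 / 4 ≤ ‖√(N : ℝ) * ⨆ i : Fin N,
            |(M.pAt i t ω - C.pHat M K t N i ω) * (M.μ0At i t ω - C.muHat M K t N i ω)|‖}) ∪
          {ω | ENNReal.ofReal (N * (ε / 2) ^ 2) ≤
            ENNReal.ofReal (C.linearPart M K t f₀ N η ω ^ 2)}) := measure_mono_ae hsub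
    _ ≤ θ / 4 + θ / 4 + θ / 4 + θ / 4 :=
        (measure_union_le _ _).trans (add_le_add ((measure_union_le _ _).trans (add_le_add
          ((measure_union_le _ _).trans (add_le_add hN1 hN2)) hN3)) hN4)
    _ = θ := by
        rw [← ENNReal.add_div, ← ENNReal.add_div, ← ENNReal.add_div,
          show θ + θ + θ + θ = 4 * θ by ring, mul_div_assoc]
        exact ENNReal.mul_div_cancel (by simp) (by simp)

end CrossFitting

end Remainder

/-! ### Random sampling and the treated share -/

section Population

variable {Ω : Type*} [mΩ : MeasurableSpace Ω] {L : Type*}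
  [MeasurableSpace L] {d J b : ℕ}

namespace LatentPanel

variable {M : LatentPanel Ω L d} {t : ℤ} {P : Measure Ω} [IsProbabilityMeasure P]
  {𝒜 : Set (EuclideanSpace ℝ (Fin d))} {K : ℝ≥0 → ℝ}

lemma measurable_unitData (M : LatentPanel Ω L d) (t : ℤ) (i : ℕ) : Measurable (M.unitData t i) :=
  (M.measurable_α i).prodMk ((M.measurable_Y0 i t).prodMk
    ((M.measurable_Y i t).prodMk (M.measurable_w i t)))

lemma sigmaPeriod_le_sigmaAll (M : LatentPanel Ω L d) (t : ℤ) : M.sigmaPeriod t ≤ M.sigmaAll := by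
  have h : Measurable[M.sigmaAll] fun ω => (fun k => M.α k ω, fun s => M.lam s ω) :=
    Measurable.of_comap_le le_rfl
  exact ((measurable_pi_apply t).comp (measurable_snd.comp h)).comap_le

variable [StandardBorelSpace Ω]

lemma RandomSampling.iCondIndepFun_comp (h : M.RandomSampling P t)
    {G : L × EuclideanSpace ℝ (Fin d) × ℝ × ℝ × ℝ → ℝ} (hG : Measurable G) :
    iCondIndepFun (M.sigmaPeriod t) (M.sigmaPeriod_le t)
      (fun i ω => G (M.lam t ω, M.unitData t i ω)) P := by
  have hle := fun i => (M.measurable_unitData t i).comap_le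
  have h1 := iCondIndep.sup_left (M.sigmaPeriod_le t) hle
    ((iCondIndepFun_iff_iCondIndep ..).1 h.indep)
  have hsup : ∀ i, M.sigmaPeriod t ⊔ MeasurableSpace.comap (M.unitData t i) inferInstance ≤ mΩ :=
    fun i => sup_le (M.sigmaPeriod_le t) (hle i)
  have hX : ∀ i, MeasurableSpace.comap (fun ω => G (M.lam t ω, M.unitData t i ω)) inferInstance ≤
      M.sigmaPeriod t ⊔ MeasurableSpace.comap (M.unitData t i) inferInstance := fun i => by
    have e1 : Measurable[M.sigmaPeriod t ⊔ MeasurableSpace.comap (M.unitData t i) inferInstance]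
        (M.lam t) := Measurable.of_comap_le le_sup_left
    have e2 : Measurable[M.sigmaPeriod t ⊔ MeasurableSpace.comap (M.unitData t i) inferInstance]
        (M.unitData t i) := Measurable.of_comap_le le_sup_right
    exact (hG.comp (e1.prodMk e2)).comap_le
  rw [iCondIndepFun_iff_iCondIndep, iCondIndep_iff _ _ _ fun i => (hX i).trans (hsup i)]
  exact fun S f hf => (iCondIndep_iff _ _ _ hsup P).1 h1 S fun i hi => hX i _ (hf i hi)

lemma RandomSampling.condExp_preimage_comp (h : M.RandomSampling P t)
    {G : L × EuclideanSpace ℝ (Fin d) × ℝ × ℝ × ℝ → ℝ} (hG : Measurable G) (i : ℕ) {s : Set ℝ}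
    (hs : MeasurableSet s) :
    P⟦(fun ω => G (M.lam t ω, M.unitData t i ω)) ⁻¹' s | M.sigmaPeriod t⟧ =ᵐ[P]
      P⟦(fun ω => G (M.lam t ω, M.unitData t 0 ω)) ⁻¹' s | M.sigmaPeriod t⟧ := by
  have hm : Measurable fun z : L × EuclideanSpace ℝ (Fin d) × ℝ × ℝ × ℝ =>
      (z.1, (G ⁻¹' s).indicator (fun _ => (1 : ℝ)) z) :=
    measurable_fst.prodMk (measurable_const.indicator (hG hs))
  refine condExp_ae_eq_of_map_prod_eq (M.measurable_lam t) ((h.ident i).comp hm) ?_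
  exact (integrable_const (1 : ℝ)).indicator ((hG.comp ((M.measurable_lam t).prodMk
    (M.measurable_unitData t i))) hs)

/-- The conditional law of large numbers for the treated share. -/
lemma RandomSampling.ae_ae_tendsto_numTreated_div (h : M.RandomSampling P t) :
    ∀ᵐ ω ∂P, ∀ᵐ ω' ∂(condExpKernel P (M.sigmaPeriod t) ω),
      Tendsto (fun N : ℕ => M.numTreated t N ω' / N) atTop (𝓝 (M.treatProb P t ω)) := by
  have hG : Measurable fun z : L × EuclideanSpace ℝ (Fin d) × ℝ × ℝ × ℝ => z.2.2.2.2 := by fun_prop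
  have hle := M.sigmaPeriod_le t
  have hw := fun i => M.measurable_w i t
  have hint : Integrable (M.w 0 t) P := Integrable.of_bound (hw 0).aestronglyMeasurable 1
    (ae_of_all _ fun ω => by rcases M.w_binary 0 t ω with h | h <;> simp [h])
  have hind : iCondIndepFun (M.sigmaPeriod t) hle (fun i => M.w i t) P := h.iCondIndepFun_comp hG
  have hd : ∀ᵐ ω ∂P, ∀ i, IdentDistrib (M.w i t) (M.w 0 t)
      (condExpKernel P (M.sigmaPeriod t) ω) (condExpKernel P (M.sigmaPeriod t) ω) :=
    ae_all_iff.2 fun i => ae_identDistrib_condExpKernel hle (hw i) (hw 0) fun s hs =>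
      h.condExp_preimage_comp hG i hs
  filter_upwards [hind.ae_iIndepFun_condExpKernel hle hw, hd,
    hint.condExpKernel_ae (m := M.sigmaPeriod t), condExp_ae_eq_integral_condExpKernel hle hint]
    with ω h1 h2 h3 h4
  have := strong_law_ae_real (fun i => M.w i t) h3 (fun i j hij => h1.indepFun hij) h2
  rw [← h4] at this
  exact this

omit [StandardBorelSpace Ω] in
lemma measurable_numTreated (M : LatentPanel Ω L d) (t : ℤ) (N : ℕ) :
    Measurable (M.numTreated t N) :=
  Finset.measurable_fun_sum _ fun i _ => M.measurable_w i t

lemma RandomSampling.ae_exists_tendsto_inv (h : M.RandomSampling P t)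
    (hπ : ∀ᵐ ω ∂P, M.treatProb P t ω ≠ 0) :
    ∀ᵐ ω ∂P, ∃ y, Tendsto (fun N : ℕ => (M.numTreated t N ω / N)⁻¹) atTop (𝓝 y) := by
  refine ae_of_ae_ae_condExpKernel (M.sigmaPeriod_le t)
    (measurableSet_exists_tendsto fun N => ((M.measurable_numTreated t N).div_const _).inv) ?_
  filter_upwards [h.ae_ae_tendsto_numTreated_div, hπ] with ω h1 h2
  filter_upwards [h1] with ω' h3 using ⟨_, h3.inv₀ h2⟩

lemma RandomSampling.ae_eventually_numTreated_ne_zero (h : M.RandomSampling P t)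
    (hπ : ∀ᵐ ω ∂P, M.treatProb P t ω ≠ 0) :
    ∀ᵐ ω ∂P, ∀ᶠ N in atTop, M.numTreated t N ω ≠ 0 := by
  refine ae_of_ae_ae_condExpKernel (M.sigmaPeriod_le t) ?_ ?_
  · simp only [eventually_atTop, Set.ofPred_exists, Set.ofPred_forall]
    exact MeasurableSet.iUnion fun n => MeasurableSet.iInter fun N => MeasurableSet.iInter fun _ =>
      (M.measurable_numTreated t N (measurableSet_singleton 0)).compl
  filter_upwards [h.ae_ae_tendsto_numTreated_div, hπ] with ω h1 h2
  filter_upwards [h1] with ω' h3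
  filter_upwards [h3.eventually_ne h2] with N hN h0
  simp [h0] at hN

section Moments

variable (h4 : M.ModelAssumption P t 𝒜 K)

include h4

lemma ModelAssumption.condExp_err (x : ℕ × obsPeriods t × Bool) :
    P[M.err t x | M.sigmaPeriod t] =ᵐ[P] 0 := by
  refine (condExp_condExp_of_le (M.sigmaPeriod_le_sigmaAll t) M.sigmaAll_le).symm.trans ?_
  refine (condExp_congr_ae (h4.err_mean x)).trans ?_
  rw [condExp_zero]

lemma ModelAssumption.memLp_err (x : ℕ × obsPeriods t × Bool) : MemLp (M.err t x) 2 P := by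
  obtain ⟨δ, hδ⟩ := h4.err_subgaussian
  exact (hδ x).memLp_two (M.measurable_err t x)

/-- Individual factors lie in `𝒜` almost surely, since they lie in the support of their law. -/
lemma ModelAssumption.ae_α_mem (i : ℕ) : ∀ᵐ ω ∂P, M.α i ω ∈ 𝒜 := by
  have h : ∀ᵐ a ∂(P.map (M.α i)), a ∈ (P.map (M.α i)).support := Measure.support_mem_ae
  have := ae_of_ae_map (M.measurable_α i).aemeasurable h
  rw [(h4.α_ident i).map_eq] at this
  filter_upwards [this] with ω hω using h4.support_subset hω

lemma ModelAssumption.memLp_μ0At (i : ℕ) : MemLp (M.μ0At i t) 2 P := by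
  obtain ⟨B, hB⟩ := h4.μ0_bdd
  refine MemLp.of_bound (M.measurable_μ0At i t).aestronglyMeasurable B ?_
  filter_upwards [h4.ae_α_mem i] with ω hω using hB _ hω _

lemma ModelAssumption.memLp_Y0 (i : ℕ) : MemLp (M.Y0 i t) 2 P := by
  have e : M.Y0 i t = M.err t (i, ⟨t, mem_obsPeriods_self t⟩, true) + M.μ0At i t := by
    ext ω; simp [err, u]
  rw [e]
  exact (h4.memLp_err _).add (h4.memLp_μ0At i)

/-- The treatment probability given the period factor inherits the lower bound of the
propensity. -/
lemma ModelAssumption.exists_le_treatProb :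
    ∃ c : ℝ, 0 < c ∧ ∀ᵐ ω ∂P, c ≤ M.treatProb P t ω := by
  obtain ⟨c, hc, hov⟩ := h4.overlap
  refine ⟨c, hc, ?_⟩
  have hle := M.sigmaPeriod_le t
  let x : ℕ × obsPeriods t × Bool := (0, ⟨t, mem_obsPeriods_self t⟩, false)
  have hint : Integrable (M.pAt 0 t) P :=
    Integrable.of_bound (M.measurable_pAt 0 t).aestronglyMeasurable 1 (by
      filter_upwards [hov 0] with ω hω
      rw [Real.norm_of_nonneg (hc.le.trans hω.1)]
      linarith [hω.2])
  have hw : M.w 0 t = M.pAt 0 t + M.err t x := by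
    ext ω; simp [err, eps, x]
  have h1 : M.treatProb P t =ᵐ[P] P[M.pAt 0 t | M.sigmaPeriod t] + P[M.err t x | M.sigmaPeriod t] := by
    unfold treatProb
    rw [hw]
    exact condExp_add hint ((h4.memLp_err x).integrable one_le_two) _
  have h2 : P[fun _ => c | M.sigmaPeriod t] ≤ᵐ[P] P[M.pAt 0 t | M.sigmaPeriod t] :=
    condExp_mono (integrable_const c) hint ((hov 0).mono fun ω hω => hω.1)
  rw [condExp_const hle] at h2
  filter_upwards [h1, h2, h4.condExp_err x] with ω h1 h2 h3
  rw [h1, Pi.add_apply, h3]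
  simpa using h2

end Moments

/-- The centred oracle score `ψ_i - w_i ATT`. -/
noncomputable def influence (M : LatentPanel Ω L d) (P : Measure Ω) (t : ℤ) (i : ℕ) (ω : Ω) : ℝ :=
  M.oracleScore t i ω - M.w i t ω * M.ATT P t ω

omit [StandardBorelSpace Ω] in
/-- The average effect is a function of the period factor, so the centred oracle score is the same
function of the period factor and the data of the individual for everybody. -/
lemma exists_influence_eq (M : LatentPanel Ω L d) (P : Measure Ω) (t : ℤ) :
    ∃ G : L × EuclideanSpace ℝ (Fin d) × ℝ × ℝ × ℝ → ℝ, Measurable G ∧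
      ∀ i, M.influence P t i = fun ω => G (M.lam t ω, M.unitData t i ω) := by
  have hATT : Measurable[M.sigmaPeriod t] (M.ATT P t) :=
    Measurable.div stronglyMeasurable_condExp.measurable stronglyMeasurable_condExp.measurable
  obtain ⟨φ, hφ, hφe⟩ := hATT.exists_eq_measurable_comp
  refine ⟨fun z => drScore z.2.2.2.1 z.2.2.2.2 (M.p t z.2.1 z.1) (M.μ0 z.2.1 z.1) -
    z.2.2.2.2 * φ z.1, ?_, fun i => ?_⟩
  · have h1 : Measurable fun z : L × EuclideanSpace ℝ (Fin d) × ℝ × ℝ × ℝ => M.p t z.2.1 z.1 :=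
      (M.measurable_p t).comp (f := fun z : L × EuclideanSpace ℝ (Fin d) × ℝ × ℝ × ℝ =>
        (z.2.1, z.1)) (by fun_prop)
    have h2 : Measurable fun z : L × EuclideanSpace ℝ (Fin d) × ℝ × ℝ × ℝ => M.μ0 z.2.1 z.1 :=
      M.measurable_μ0.comp (f := fun z : L × EuclideanSpace ℝ (Fin d) × ℝ × ℝ × ℝ =>
        (z.2.1, z.1)) (by fun_prop)
    unfold drScore
    fun_prop
  · ext ω
    rw [influence, hφe]
    rfl

end LatentPanel

end Population

/-! ### The oracle score -/

section Influence

variable {Ω : Type*} [mΩ : MeasurableSpace Ω] [StandardBorelSpace Ω] {L : Type*}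
  [MeasurableSpace L] {d J b : ℕ}

namespace LatentPanel

variable {M : LatentPanel Ω L d} {t : ℤ} {P : Measure Ω} [IsProbabilityMeasure P]
  {𝒜 : Set (EuclideanSpace ℝ (Fin d))} {K : ℝ≥0 → ℝ}

/-- The inverse-propensity weight `ε_{i,t} / (1 - p_{i,t})` of the outcome residual in the score. -/
noncomputable def residualWeight (M : LatentPanel Ω L d) (t : ℤ) (i : ℕ) (ω : Ω) : ℝ :=
  M.eps i t ω / (1 - M.pAt i t ω)

omit [StandardBorelSpace Ω] in
lemma measurable_residualWeight (M : LatentPanel Ω L d) (t : ℤ) (i : ℕ) :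
    Measurable (M.residualWeight t i) :=
  ((M.measurable_w i t).sub (M.measurable_pAt i t)).div
    (measurable_const.sub (M.measurable_pAt i t))

omit [StandardBorelSpace Ω] in
lemma abs_w_le_one (M : LatentPanel Ω L d) (i : ℕ) (s : ℤ) (ω : Ω) : |M.w i s ω| ≤ 1 := by
  rcases M.w_binary i s ω with h | h <;> simp [h]

lemma ModelAssumption.exists_residualWeight_le (h4 : M.ModelAssumption P t 𝒜 K) (i : ℕ) :
    ∃ B : ℝ, ∀ᵐ ω ∂P, |M.residualWeight t i ω| ≤ B := by
  obtain ⟨c, hc, hov⟩ := h4.overlap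
  refine ⟨1 / c, ?_⟩
  filter_upwards [hov i] with ω hω
  have h1 : c ≤ 1 - M.pAt i t ω := by linarith [hω.2]
  rw [residualWeight, abs_div, abs_of_pos (hc.trans_le h1)]
  refine div_le_div₀ zero_le_one ?_ hc h1
  rw [eps, abs_le]
  rcases M.w_binary i t ω with h | h <;> rw [h] <;> constructor <;> linarith [hω.1, hω.2]

lemma memLp_treated_effect (h4 : M.ModelAssumption P t 𝒜 K) (hs : M.RandomSampling P t) :
    MemLp (fun ω => M.w 0 t ω * (M.Y 0 t ω - M.Y0 0 t ω)) 2 P :=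
  ((hs.sq_integrable 0).sub (h4.memLp_Y0 0)).of_abs_mul_le (M.measurable_w 0 t)
    (ae_of_all _ fun ω => M.abs_w_le_one 0 t ω)

lemma memLp_weighted_residual (h4 : M.ModelAssumption P t 𝒜 K) :
    MemLp (fun ω => M.residualWeight t 0 ω * M.u 0 t ω) 2 P := by
  obtain ⟨B, hB⟩ := h4.exists_residualWeight_le 0
  exact (h4.memLp_err (0, ⟨t, mem_obsPeriods_self t⟩, true)).of_abs_mul_le
    (M.measurable_residualWeight t 0) hB

omit [StandardBorelSpace Ω] in
lemma measurable_ATT (M : LatentPanel Ω L d) (P : Measure Ω) (t : ℤ) :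
    Measurable[M.sigmaPeriod t] (M.ATT P t) :=
  Measurable.div stronglyMeasurable_condExp.measurable stronglyMeasurable_condExp.measurable

lemma memLp_ATT (h4 : M.ModelAssumption P t 𝒜 K) (hs : M.RandomSampling P t) :
    MemLp (M.ATT P t) 2 P := by
  obtain ⟨c, hc, hπ⟩ := h4.exists_le_treatProb
  have hle := M.sigmaPeriod_le t
  have h := (memLp_treated_effect h4 hs).condExp (m := M.sigmaPeriod t) one_le_two
  have hπm : Measurable (M.treatProb P t) := (stronglyMeasurable_condExp.mono hle).measurable
  refine (h.of_abs_mul_le hπm.inv (B := 1 / c) ?_).ae_eq (ae_of_all _ fun ω => ?_)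
  · filter_upwards [hπ] with ω hω
    rw [Pi.inv_apply, abs_inv, abs_of_pos (hc.trans_le hω), one_div]
    exact inv_anti₀ hc hω
  · simp only [ATT, Pi.inv_apply, div_eq_inv_mul]

/-- The centred oracle score is the effect on a treated individual plus a weighted outcome
residual, minus `w ATT`. -/
lemma influence_ae_eq (h1 : M.NoAnticipation P t) (h4 : M.ModelAssumption P t 𝒜 K) :
    M.influence P t 0 =ᵐ[P] fun ω => M.w 0 t ω * (M.Y 0 t ω - M.Y0 0 t ω) +
      M.residualWeight t 0 ω * M.u 0 t ω - M.w 0 t ω * M.ATT P t ω := by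
  obtain ⟨c, hc, hov⟩ := h4.overlap
  filter_upwards [h1 0 t (mem_obsPeriods_self t), hov 0] with ω hY hω
  have hp : 1 - M.pAt 0 t ω ≠ 0 := by intro h; linarith [hω.2]
  unfold influence oracleScore drScore residualWeight eps u
  rcases M.w_binary 0 t ω with h | h
  · rw [hY h, h]; field_simp; ring
  · rw [h]; field_simp; ring

lemma memLp_influence (h1 : M.NoAnticipation P t) (h4 : M.ModelAssumption P t 𝒜 K)
    (hs : M.RandomSampling P t) : MemLp (M.influence P t 0) 2 P :=
  (((memLp_treated_effect h4 hs).add (memLp_weighted_residual h4)).sub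
    ((memLp_ATT h4 hs).of_abs_mul_le (M.measurable_w 0 t)
      (ae_of_all _ fun ω => M.abs_w_le_one 0 t ω))).ae_eq (influence_ae_eq h1 h4).symm

/-- The weight of the residual involves the treatment error and the latent factors only, so the
outcome error is orthogonal to it. -/
lemma condExp_weighted_residual (h4 : M.ModelAssumption P t 𝒜 K) :
    P[fun ω => M.residualWeight t 0 ω * M.u 0 t ω | M.sigmaPeriod t] =ᵐ[P] 0 := by
  have hle := M.sigmaPeriod_le t
  have hint := (memLp_weighted_residual h4).integrable one_le_two
  let x : ℕ × obsPeriods t × Bool := (0, ⟨t, mem_obsPeriods_self t⟩, true)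
  symm
  refine ae_eq_condExp_of_forall_setIntegral_eq hle hint (fun s _ _ => by simp [IntegrableOn])
    (fun A hA _ => ?_) aestronglyMeasurable_zero
  have hA' : MeasurableSet[M.sigmaAll] A := M.sigmaPeriod_le_sigmaAll t A hA
  have he : ∀ ω, A.indicator (fun ω => M.residualWeight t 0 ω * M.u 0 t ω) ω =
      A.indicator (M.residualWeight t 0) ω * M.err t x ω := fun ω => by
    by_cases hω : ω ∈ A <;> simp [hω, err, x]
  have hxx : ((0, ⟨t, mem_obsPeriods_self t⟩, false) : ℕ × obsPeriods t × Bool) ≠ x := by simp [x]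
  have hp := (M.measurable_pAt_sigmaAll 0 t).mono (le_sigmaExcept M.sigmaAll (M.err t) x) le_rfl
  have hZ : Measurable[sigmaExcept M.sigmaAll (M.err t) x] (M.residualWeight t 0) :=
    ((M.measurable_w_sigmaExcept t _ hxx).sub hp).div (measurable_const.sub hp)
  rw [← integral_indicator (hle _ hA), ← integral_indicator (hle _ hA)]
  simp_rw [he]
  rw [integral_mul_eq_zero_of_iCondIndepFun M.sigmaAll_le (M.measurable_err t) h4.err_indep
    ((h4.memLp_err x).integrable one_le_two) (h4.err_mean x)
    (hZ.indicator (le_sigmaExcept M.sigmaAll (M.err t) x A hA'))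
    ((hint.indicator (hle _ hA)).congr (ae_of_all _ he))]
  simp

/-- The centred oracle score has mean zero given the period factor: the weighted residual does, and
the average effect is by definition the ratio of the other two means. -/
lemma condExp_influence (h1 : M.NoAnticipation P t) (h4 : M.ModelAssumption P t 𝒜 K)
    (hs : M.RandomSampling P t) : P[M.influence P t 0 | M.sigmaPeriod t] =ᵐ[P] 0 := by
  obtain ⟨c, hc, hπ⟩ := h4.exists_le_treatProb
  have hi1 := (memLp_treated_effect h4 hs).integrable one_le_two
  have hi2 := (memLp_weighted_residual h4).integrable one_le_two
  have hi3 : Integrable (fun ω => M.w 0 t ω * M.ATT P t ω) P :=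
    ((memLp_ATT h4 hs).of_abs_mul_le (M.measurable_w 0 t)
      (ae_of_all _ fun ω => M.abs_w_le_one 0 t ω)).integrable one_le_two
  have hw : Integrable (M.w 0 t) P := Integrable.of_bound (M.measurable_w 0 t).aestronglyMeasurable 1
    (ae_of_all _ fun ω => M.abs_w_le_one 0 t ω)
  have e1 := condExp_congr_ae (m := M.sigmaPeriod t) (influence_ae_eq h1 h4)
  have e2 := condExp_sub (hi1.add hi2) hi3 (M.sigmaPeriod t)
  have e3 := condExp_add hi1 hi2 (M.sigmaPeriod t)
  have e4 := condExp_mul_of_stronglyMeasurable_right (M.measurable_ATT P t).stronglyMeasurable hi3 hw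
  filter_upwards [e1, e2, e3, e4, condExp_weighted_residual h4, hπ] with ω e1 e2 e3 e4 e5 hπ
  have hπ0 : M.treatProb P t ω ≠ 0 := (hc.trans_le hπ).ne'
  rw [e1]
  refine e2.trans ?_
  rw [Pi.sub_apply, e3, Pi.add_apply, e5]
  rw [show (P[fun ω => M.w 0 t ω * M.ATT P t ω | M.sigmaPeriod t]) ω = _ from e4]
  simp only [Pi.mul_apply, Pi.zero_apply, add_zero]
  change _ - M.treatProb P t ω * M.ATT P t ω = 0
  unfold ATT
  field_simp
  simp

end LatentPanel

end Influence

/-! ### The estimator of the effect -/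

theorem theorem2 {Ω : Type*} [MeasurableSpace Ω] [StandardBorelSpace Ω]
    {L : Type*} [MeasurableSpace L] (P : Measure Ω) [IsProbabilityMeasure P] {d J b : ℕ}
    (M : LatentPanel Ω L d) (t : ℤ) (ht : 0 < t)
    (𝒜 : Set (EuclideanSpace ℝ (Fin d))) (K : ℝ≥0 → ℝ)
    (h1 : M.NoAnticipation P t) (h2 : M.LatentUnconfoundedness P t)
    (h3 : M.LatentIndependence P t) (h4 : M.ModelAssumption P t 𝒜 K)
    (hsampling : M.RandomSampling P t)
    (C : CrossFitting Ω J b) (hfold : C.FoldsIndependent M P)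
    (hp : IsLittleOpOne P fun N ω => ⨆ i : Fin N, |C.pHat M K t N i ω - M.pAt i t ω|)
    (hμ : IsLittleOpOne P fun N ω => ⨆ i : Fin N, |C.muHat M K t N i ω - M.μ0At i t ω|)
    (hprod : IsLittleOpOne P fun N ω => √(N : ℝ) * ⨆ i : Fin N,
      |(M.pAt i t ω - C.pHat M K t N i ω) * (M.μ0At i t ω - C.muHat M K t N i ω)|)
    (c : Fin J → ℝ) (hc : ∀ k, 0 < c k)
    (hsize : ∀ k, TendstoInMeasure P
      (fun (N : ℕ) ω => ((C.foldSet N ω k).card : ℝ) / N) atTop fun _ => c k) :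
    IsLittleOpOne P
        (fun N ω => √(N : ℝ) * C.attHat M K t N ω - √(N : ℝ) * M.oracleATT t N ω) ∧
      CondAsympNormal P (M.sigmaPeriod t)
        (fun N ω => √(N : ℝ) * (C.attHat M K t N ω - M.ATT P t ω)) (M.asympVar P t) := by
  obtain ⟨κ, hκ⟩ := h4.K_lipschitz
  have hK : Measurable K := hκ.continuous.measurable
  obtain ⟨π₀, hπ₀, hπ⟩ := h4.exists_le_treatProb
  have hπ0 : ∀ᵐ ω ∂P, M.treatProb P t ω ≠ 0 := hπ.mono fun ω hω => (hπ₀.trans_le hω).ne'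
  have hinv : ∀ᵐ ω ∂P, Tendsto (fun N : ℕ => (M.numTreated t N ω / N)⁻¹) atTop
      (𝓝 (limUnder atTop fun N : ℕ => (M.numTreated t N ω / N)⁻¹)) :=
    (hsampling.ae_exists_tendsto_inv hπ0).mono fun ω hω => tendsto_nhds_limUnder hω
  have herr := C.tendstoInMeasure_scoreError M t ht h1 h4 hfold hp hμ hprod
  have hatt := C.measurable_attHat M t hK
  have hATT : Measurable (M.ATT P t) := (M.measurable_ATT P t).mono (M.sigmaPeriod_le t) le_rfl
  obtain ⟨G, hG, hGe⟩ := M.exists_influence_eq P t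
  have hinf : ∀ i, Measurable (M.influence P t i) := fun i => by
    rw [hGe i]
    exact hG.comp ((M.measurable_lam t).prodMk (M.measurable_unitData t i))
  have hn := M.measurable_numTreated t
  have hsc : ∀ i, Measurable (M.oracleScore t i) := fun i => by
    have e : M.oracleScore t i = fun ω => M.influence P t i ω + M.w i t ω * M.ATT P t ω := by
      ext ω; simp [LatentPanel.influence]
    rw [e]
    exact (hinf i).add ((M.measurable_w i t).mul hATT)
  have hor : ∀ N, Measurable (M.oracleATT t N) := fun N =>
    (Finset.measurable_fun_sum _ fun i _ => hsc i).div (hn N)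
  have hdiff : ∀ (N : ℕ) ω, √(N : ℝ) * C.attHat M K t N ω - √(N : ℝ) * M.oracleATT t N ω =
      (√(N : ℝ))⁻¹ * C.scoreError M K t N ω * (M.numTreated t N ω / N)⁻¹ := fun N ω => by
    have hs : √(N : ℝ) = (√(N : ℝ))⁻¹ * N := by
      rcases Nat.eq_zero_or_pos N with rfl | hN
      · simp
      · have : 0 < √(N : ℝ) := Real.sqrt_pos.2 (Nat.cast_pos.2 hN)
        rw [eq_inv_mul_iff_mul_eq₀ this.ne', Real.mul_self_sqrt (Nat.cast_nonneg N)]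
    unfold CrossFitting.scoreError CrossFitting.attHat LatentPanel.oracleATT
    rw [Finset.sum_sub_distrib, ← mul_sub, ← sub_div, inv_div]
    nth_rewrite 1 [hs]
    ring
  constructor
  · have := tendstoInMeasure_mul_add_of_tendsto_ae (e := fun _ _ => 0) herr hinv
      (ae_of_all _ fun _ => tendsto_const_nhds) fun N =>
        ((((hatt N).const_mul √(N : ℝ)).sub ((hor N).const_mul √(N : ℝ))).aestronglyMeasurable).congr
          (ae_of_all _ fun ω => by simp [hdiff N ω])
    simp only [add_zero, ← hdiff] at this
    exact this
  · refine condAsympNormal_of_condIndep (M.sigmaPeriod_le t) (X := M.influence P t)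
      (W := fun i => M.w i t) (π := M.treatProb P t) hinf (fun i => M.measurable_w i t)
      (fun N => ((hatt N).sub hATT).const_mul _) (LatentPanel.memLp_influence h1 h4 hsampling) ?_
      (fun i s hs => ?_) (LatentPanel.condExp_influence h1 h4 hsampling) hπ0
      hsampling.ae_ae_tendsto_numTreated_div EventuallyEq.rfl ?_
    · rw [show M.influence P t = _ from funext hGe]
      exact hsampling.iCondIndepFun_comp hG
    · rw [hGe i, hGe 0]
      exact hsampling.condExp_preimage_comp hG i hs
    · let T : ℕ → Ω → ℝ := fun N ω => ((√(N : ℝ))⁻¹ * ∑ i ∈ Finset.range N, M.influence P t i ω) *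
        ((∑ i ∈ Finset.range N, M.w i t ω) / N)⁻¹
      have hT : ∀ N, Measurable (T N) := fun N => by
        have := fun i => M.measurable_w i t
        fun_prop
      -- The studentized sum differs from the centred oracle estimate only in samples without
      -- treated individuals, where both ratios are junk.
      have hzero : ∀ᵐ ω ∂P, Tendsto
          (fun N : ℕ => √(N : ℝ) * (M.oracleATT t N ω - M.ATT P t ω) - T N ω) atTop (𝓝 0) := by
        filter_upwards [hsampling.ae_eventually_numTreated_ne_zero hπ0] with ω hω
        refine tendsto_const_nhds.congr' ?_
        filter_upwards [hω, eventually_gt_atTop 0] with N hN hN0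
        have hN' : (0 : ℝ) < N := Nat.cast_pos.2 hN0
        have hs : 0 < √(N : ℝ) := Real.sqrt_pos.2 hN'
        have hss : √(N : ℝ) * √N = N := Real.mul_self_sqrt hN'.le
        have hsum : ∑ i ∈ Finset.range N, M.influence P t i ω =
            (∑ i ∈ Finset.range N, M.oracleScore t i ω) - M.numTreated t N ω * M.ATT P t ω := by
          simp only [LatentPanel.influence, LatentPanel.numTreated, Finset.sum_sub_distrib,
            Finset.sum_mul]
        have hnum : ∑ i ∈ Finset.range N, M.w i t ω = M.numTreated t N ω := rfl
        simp only [T, hsum, hnum, LatentPanel.oracleATT]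
        rw [inv_div, ← hss, Real.sqrt_mul_self hs.le]
        field_simp
        ring
      have key := tendstoInMeasure_mul_add_of_tendsto_ae herr hinv hzero fun N => by
        simp only [← hdiff]
        exact ((((hatt N).const_mul _).sub ((hor N).const_mul _)).add
          ((((hor N).sub hATT).const_mul _).sub (hT N))).aestronglyMeasurable
      simp only [← hdiff] at key
      refine key.congr_left fun N => ae_of_all _ fun ω => ?_
      simp only [T]
      ring
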